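/- For every $\alpha\in(0,1]$ there is a constant $C>0$, depending only on $\alpha$, such that the following holds. Let $n,d,w\in\mathbb N$ with $d\le 2^n$, let $\Lambda\ge 0$, $t>0$, $0<\epsilon\le 1$, set $\tau:=d\Lambda t$ and assume $\tau\ge 1$; fix a map $\mathrm{val}:\{0,1\}^w\to\mathbb C$ that decodes $w$-bit strings as complex numbers. Then there is a quantum query algorithm, depending only on these data and making at most $$C\left(\tau^{1+\alpha/2}+\tau^{1-\alpha/2}\log(1/\epsilon)\right)$$ queries, that simulates every $d$-sparse Hamiltonian $H$ on $n$ qubits (a Hermitian $2^n\times 2^n$ matrix with at most $d$ nonzero entries in each row) with $\|H\|_{\max}:=\max_{j,k}|H_{jk}|\le\Lambda$ (in particular those with $\|H\|_{\max}=\Lambda$, where $\tau=d\|H\|_{\max}t$) whose entries lie in the range of $\mathrm{val}$, for time $t$ within error $\epsilon$: given any black boxes for $H$, the operation that the algorithm performs on the $n$-qubit system is within diamond-norm distance $\epsilon$ of $\rho\mapsto e^{-iHt}\rho\,e^{iHt}$. Here black boxes for $H$ are two unitaries $O_H$, $O_F$ with $O_H|j,k,z\rangle=|j,k,z\oplus h_{jk}\rangle$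 for all $j,k\in[2^n]$ and $z\in\{0,1\}^w$, where $\mathrm{val}(h_{jk})=H_{jk}$, and $O_F|j,\ell\rangle=|j,f(j,\ell)\rangle$ for $j\in[2^n]$, $\ell\in[d]$, where $f(j,1),\dots,f(j,d)\in[2^n]$ are distinct and include all columns of nonzero entries of row $j$. A query algorithm starts with the input in the $n$-qubit system and with the query registers and a finite-dimensional workspace in a fixed basis state, applies a finite sequence of arbitrary unitaries not depending on $H$ and queries to $O_H$, $O_F$, $O_F^\dagger$ (each counted once), and finally discards everything but the system. -/

import Mathlib

open scoped Kronecker Matrix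

noncomputable section

namespace HamSim

/-! ### Linear algebra -/

/-- The computational basis vector `|x⟩`. -/
def ket {B : Type} [DecidableEq B] (x : B) : B → ℂ := Pi.single x 1

/-- The largest absolute value of an entry. -/
def maxNorm {B : Type} (H : Matrix B B ℂ) : ℝ := ⨆ p : B × B, ‖H p.1 p.2‖

/-- At most `d` nonzero entries in every row. -/
def IsSparse {B : Type} (d : ℕ) (H : Matrix B B ℂ) : Prop :=
  ∀ j, {k | H j k ≠ 0}.ncard ≤ d

/-- The trace norm (Schatten 1-norm): the sum of the singular values, i.e. of the square roots of
the eigenvalues of `Xᴴ * X`. -/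
def traceNorm {B : Type} [Fintype B] [DecidableEq B] (X : Matrix B B ℂ) : ℝ :=
  ∑ i, Real.sqrt ((Matrix.isHermitian_conjTranspose_mul_self X).eigenvalues i)

/-- Linear maps on the operators on the space with basis `B`. -/
abbrev SuperOp (B : Type) : Type := Matrix B B ℂ →ₗ[ℂ] Matrix B B ℂ

/-- `Φ ⊗ id`, where `id` acts on the operators on a reference system of dimension `k`. -/
def ampliate {B : Type} (k : ℕ) (Φ : SuperOp B) (X : Matrix (B × Fin k) (B × Fin k) ℂ) :
    Matrix (B × Fin k) (B × Fin k) ℂ :=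
  Matrix.of fun x y => Φ (Matrix.of fun i j => X (i, x.2) (j, y.2)) x.1 y.1

/-- The diamond norm: the supremum of `‖(Φ ⊗ id)(X)‖₁` over all finite-dimensional reference
systems and all operators `X` with `‖X‖₁ ≤ 1`. -/
def diamondNorm {B : Type} [Fintype B] [DecidableEq B] (Φ : SuperOp B) : ENNReal :=
  ⨆ (k : ℕ) (X : Matrix (B × Fin k) (B × Fin k) ℂ) (_ : traceNorm X ≤ 1),
    ENNReal.ofReal (traceNorm (ampliate k Φ X))

/-- The map `ρ ↦ U ρ U†`. -/
def conjBy {B : Type} [Fintype B] (U : Matrix B B ℂ) : SuperOp B where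
  toFun ρ := U * ρ * Uᴴ
  map_add' ρ σ := by rw [Matrix.mul_add, Matrix.add_mul]
  map_smul' c ρ := by simp

/-- The map `ρ ↦ Tr_A (C (ρ ⊗ |a⟩⟨a|) C†)`: adjoin the ancilla `A` in the basis state `a`,
apply `C`, discard the ancilla. -/
def dilated {B A : Type} [Fintype B] [Fintype A] [DecidableEq A]
    (C : Matrix (B × A) (B × A) ℂ) (a : A) : SuperOp B where
  toFun ρ := Matrix.of fun i j => ∑ x, (C * (ρ ⊗ₖ Matrix.single a a (1 : ℂ)) * Cᴴ) (i, x) (j, x)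
  map_add' ρ σ := by
    ext i j
    simp [Matrix.add_kronecker, Matrix.mul_add, Matrix.add_mul, Finset.sum_add_distrib]
  map_smul' c ρ := by
    ext i j
    simp [Matrix.smul_kronecker, Finset.mul_sum]

/-! ### Oracles for a sparse Hamiltonian on `n` qubits -/

/-- Bitwise addition modulo 2. -/
def bitXor {w : ℕ} (y z : Fin w → Bool) : Fin w → Bool := fun i => xor (y i) (z i)

/-- Basis of the query registers: two `n`-qubit indices and a `w`-bit string. -/
abbrev QueryReg (n w : ℕ) : Type := Fin (2 ^ n) × Fin (2 ^ n) × (Fin w → Bool)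

/-- The two black boxes, as unitaries on the registers on which they act. -/
structure Oracles (n w : ℕ) where
  OH : Matrix.unitaryGroup (QueryReg n w) ℂ
  OF : Matrix.unitaryGroup (Fin (2 ^ n) × Fin (2 ^ n)) ℂ

/-- `O` is a pair of black boxes for the `d`-sparse Hamiltonian `H`, whose entries are represented
by `w`-bit strings through the decoding map `val`:
`O_H |j,k,z⟩ = |j,k,z ⊕ H_jk⟩`, and `O_F |j,ℓ⟩ = |j,f(j,ℓ)⟩` for `ℓ ∈ [d]`, where
`f(j,1), …, f(j,d)` list (the columns of) all nonzero entries of row `j`. If the row has fewer than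
`d` of them the remaining positions of the list are arbitrary, and so is the action of `O_F` on
`|j,m⟩` for `m` outside `[d]`. (Unitarity of `O_F` forces `f(j,·)` to be injective.) -/
structure Oracles.IsFor {n d w : ℕ} (hd : d ≤ 2 ^ n) (val : (Fin w → Bool) → ℂ)
    (H : Matrix (Fin (2 ^ n)) (Fin (2 ^ n)) ℂ) (O : Oracles n w) : Prop where
  entries : ∃ h : Fin (2 ^ n) → Fin (2 ^ n) → (Fin w → Bool),
    (∀ j k, val (h j k) = H j k) ∧
    ∀ j k z, (O.OH : Matrix _ _ ℂ) *ᵥ ket (j, k, z) = ket (j, k, bitXor z (h j k))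
  positions : ∃ f : Fin (2 ^ n) → Fin d → Fin (2 ^ n),
    (∀ j k, H j k ≠ 0 → ∃ ℓ, f j ℓ = k) ∧
    ∀ j ℓ, (O.OF : Matrix _ _ ℂ) *ᵥ ket (j, Fin.castLE hd ℓ) = ket (j, f j ℓ)

/-! ### Quantum query algorithms -/

/-- One step of an algorithm on system ⊗ query registers ⊗ workspace: an arbitrary unitary that
does not depend on the oracles, or a query to `O_H` (its own inverse), to `O_F` or to `O_F†`. -/
inductive Step (n w : ℕ) (W : Type) [Fintype W] [DecidableEq W] : Type
  | gate (G : Matrix.unitaryGroup (Fin (2 ^ n) × (QueryReg n w × W)) ℂ) : Step n w W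
  | queryH : Step n w W
  | queryF : Step n w W
  | queryFInv : Step n w W

/-- An operator on the first two query registers, acting on all three. -/
def onIndices {n w : ℕ}
    (M : Matrix (Fin (2 ^ n) × Fin (2 ^ n)) (Fin (2 ^ n) × Fin (2 ^ n)) ℂ) :
    Matrix (QueryReg n w) (QueryReg n w) ℂ :=
  Matrix.reindex (Equiv.prodAssoc _ _ _) (Equiv.prodAssoc _ _ _)
    (M ⊗ₖ (1 : Matrix (Fin w → Bool) (Fin w → Bool) ℂ))

/-- An operator on the query registers, acting on the whole space. -/
def onQuery {n w : ℕ} {W : Type} [DecidableEq W] (M : Matrix (QueryReg n w) (QueryReg n w) ℂ) :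
    Matrix (Fin (2 ^ n) × (QueryReg n w × W)) (Fin (2 ^ n) × (QueryReg n w × W)) ℂ :=
  (1 : Matrix (Fin (2 ^ n)) (Fin (2 ^ n)) ℂ) ⊗ₖ (M ⊗ₖ (1 : Matrix W W ℂ))

/-- The operator that a step applies. -/
def Step.op {n w : ℕ} {W : Type} [Fintype W] [DecidableEq W] (O : Oracles n w) :
    Step n w W →
      Matrix (Fin (2 ^ n) × (QueryReg n w × W)) (Fin (2 ^ n) × (QueryReg n w × W)) ℂ
  | .gate G => G
  | .queryH => onQuery (O.OH : Matrix _ _ ℂ)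
  | .queryF => onQuery (onIndices (O.OF : Matrix _ _ ℂ))
  | .queryFInv => onQuery (onIndices (O.OF : Matrix _ _ ℂ)ᴴ)

/-- The number of queries that a step makes. -/
def Step.cost {n w : ℕ} {W : Type} [Fintype W] [DecidableEq W] : Step n w W → ℕ
  | .gate _ => 0
  | .queryH => 1
  | .queryF => 1
  | .queryFInv => 1

/-- A quantum query algorithm acting on `n` system qubits: a finite-dimensional workspace with an
initial basis state, and a finite sequence of steps. -/
structure QueryAlgorithm (n w : ℕ) where
  Work : Type
  [fintypeWork : Fintype Work]
  [decEqWork : DecidableEq Work]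
  init : Work
  steps : List (Step n w Work)

attribute [instance] QueryAlgorithm.fintypeWork QueryAlgorithm.decEqWork

/-- The total number of oracle queries (to `O_H`, `O_F` and `O_F†` together). -/
def QueryAlgorithm.queries {n w : ℕ} (A : QueryAlgorithm n w) : ℕ :=
  (A.steps.map Step.cost).sum

/-- The product of the steps; the head of the list is applied first. -/
def QueryAlgorithm.circuit {n w : ℕ} (A : QueryAlgorithm n w) (O : Oracles n w) :
    Matrix (Fin (2 ^ n) × (QueryReg n w × A.Work)) (Fin (2 ^ n) × (QueryReg n w × A.Work)) ℂ :=
  A.steps.foldl (fun M s => s.op O * M) 1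

/-- The operation on the system implemented by the algorithm: the query registers start in
`|0,0,0…0⟩`, the workspace in its initial state, and both are discarded at the end. -/
def QueryAlgorithm.channel {n w : ℕ} (A : QueryAlgorithm n w) (O : Oracles n w) :
    SuperOp (Fin (2 ^ n)) :=
  dilated (A.circuit O) ((0, 0, fun _ => false), A.init)

/-- The time evolution `e^{-iHt}`. -/
def evolution {n : ℕ} (H : Matrix (Fin (2 ^ n)) (Fin (2 ^ n)) ℂ) (t : ℝ) :
    Matrix (Fin (2 ^ n)) (Fin (2 ^ n)) ℂ :=
  NormedSpace.exp ((-(Complex.I * (t : ℂ))) • H)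

/-- With black boxes for `H`, the algorithm simulates `H` for time `t` to within diamond-norm
distance `ε`. -/
def QueryAlgorithm.Simulates {n w : ℕ} (A : QueryAlgorithm n w) (O : Oracles n w)
    (H : Matrix (Fin (2 ^ n)) (Fin (2 ^ n)) ℂ) (t ε : ℝ) : Prop :=
  diamondNorm (A.channel O - conjBy (evolution H t)) ≤ ENNReal.ofReal ε

end HamSim

end

/-!
The stated bound follows from the stronger one `O(τ + log (1 / ε))`, because `τ ≤ τ ^ (1 + α / 2)` and
`1 ≤ τ ^ (1 - α / 2)` for `τ ≥ 1`. The algorithm that achieves it is quantum signal processing applied to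
a quantum walk.

*Block encoding.* Three queries prepare, from a row index `i`, the superposition of the columns listed for
row `i`, each with a four-dimensional coin whose state depends on the matrix entry. Call this isometry `T`.
The self-inverse unitary `G` that swaps the two index registers and flips the coin satisfies
`T† G T = h` with `h = H / (d Λ)` (`blockEncoding`). The walk operator `W = G (2 T T† - 1)` then satisfies
`(W + W⁻¹) / 2 · T = T h` (`walk_sq_add_one_mul`), so every polynomial in `(W + W⁻¹) / 2` acts on the range
of `T` as the same polynomial in `h`; no eigenvectors are needed.

*The polynomial.* Let `f` be the Taylor polynomial of degree `K` of `exp (-i τ x)` and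
`P(z) = z ^ K f((z + z⁻¹) / 2)`, a polynomial of degree `2 K`. In the product of `f` with its conjugate the
terms of degree between `1` and `K` cancel, so the Fourier coefficients of `|P|² - 1` on the unit circle have
exponentially small absolute sum once `K` exceeds a multiple of `τ + log (1 / ε)`
(`abs_completionBound_sub_one_le`). For each nonconstant Fourier mode a suitable binomial `a + b z ^ l` has
squared modulus with the opposite mode. Adjoining these binomials to `P` gives a vector polynomial whose norm
is constant on the circle (`unitOnCircle_binomialCompletion`) and close to one.

*The circuit.* A normalized vector polynomial of degree `L` is a product of `L` factors `z Q + (1 - Q)`, with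
orthogonal projections `Q`, applied to a constant unit vector (`UnitOnCircle.exists_factorization`). Replacing
`z` by `W` turns each factor into a controlled walk step. The circuit prepares the constant vector in an
additional register, applies `T`, the `2 K` controlled steps, `W ^ (-K)` and the inverse of `T`. Its block at
the initial state of all ancillas is a multiple, with factor close to one, of `f(h)`
(`krausOp_simulationOp`), hence close to `exp (-i H t)`.

*The diamond norm.* The circuit is unitary, so if this block is `δ`-close to a unitary, the other blocks
are of order `√δ`, and so is the diamond distance (`diamondNorm_dilated_sub_conjBy_le`). This uses the duality
of trace norm and operator norm, proved from the singular value decomposition. Taking `δ` of order `ε ^ 2`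
changes `log (1 / δ)` only by a constant factor.
-/

noncomputable section

namespace HamSim

/-! ### Trace norm and diamond norm -/

section

open scoped Matrix.Norms.L2Operator

lemma matrix_orthonormalBasis_mem_unitary {ι : Type*} [Fintype ι] [DecidableEq ι]
    (b : OrthonormalBasis ι ℂ (EuclideanSpace ℂ ι)) :
    (Matrix.of fun k i => b i k) ∈ Matrix.unitaryGroup ι ℂ := by
  rw [Matrix.mem_unitaryGroup_iff', Matrix.star_eq_conjTranspose]
  ext i j
  have := b.inner_eq_ite i j
  rw [EuclideanSpace.inner_eq_star_dotProduct] at this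
  rw [Matrix.one_apply, ← this, Matrix.mul_apply, dotProduct]
  exact Finset.sum_congr rfl fun k _ => mul_comm _ _

/-- Every unit vector is a column of some unitary, so every state can be prepared by a gate. -/
lemma exists_unitary_column {ι : Type*} [Fintype ι] [DecidableEq ι] (i₀ : ι) (u : ι → ℂ)
    (hu : ∑ i, ‖u i‖ ^ 2 = 1) :
    ∃ U ∈ Matrix.unitaryGroup ι ℂ, ∀ i, U i i₀ = u i := by
  have hn : ‖WithLp.toLp 2 u‖ = 1 := by
    rw [EuclideanSpace.norm_eq]; simp [hu]
  obtain ⟨b, hb⟩ := Orthonormal.exists_orthonormalBasis_extension_of_card_eq (𝕜 := ℂ)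
    (ι := ι) (E := EuclideanSpace ℂ ι) (by simp) (v := fun _ => WithLp.toLp 2 u) (s := {i₀})
    (by
      refine ⟨fun i => by simpa [Set.domRestrict] using hn, ?_⟩
      intro i j hij
      exact absurd (Subsingleton.elim i j) hij)
  refine ⟨_, matrix_orthonormalBasis_mem_unitary b, fun i => ?_⟩
  simp [hb i₀ rfl]

open scoped ComplexOrder in
/-- The singular value decomposition of a square matrix, with the singular values in the form in
which `traceNorm` sums them. -/
theorem exists_singularValueDecomposition {ι : Type} [Fintype ι] [DecidableEq ι]
    (X : Matrix ι ι ℂ) :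
    ∃ B ∈ Matrix.unitaryGroup ι ℂ, ∃ E ∈ Matrix.unitaryGroup ι ℂ,
      X = B * Matrix.diagonal (fun i => ((Real.sqrt
        ((Matrix.isHermitian_conjTranspose_mul_self X).eigenvalues i) : ℝ) : ℂ)) * Eᴴ := by
  set hX := Matrix.isHermitian_conjTranspose_mul_self X
  set σ : ι → ℝ := fun i => Real.sqrt (hX.eigenvalues i) with hσ
  have hpos : ∀ i, 0 ≤ hX.eigenvalues i :=
    (Matrix.posSemidef_conjTranspose_mul_self X).eigenvalues_nonneg
  set E : Matrix ι ι ℂ := (hX.eigenvectorUnitary : Matrix ι ι ℂ) with hE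
  have hEE : E * Eᴴ = 1 := Matrix.mem_unitaryGroup_iff.mp hX.eigenvectorUnitary.2
  have hEE' : Eᴴ * E = 1 := Matrix.mem_unitaryGroup_iff'.mp hX.eigenvectorUnitary.2
  have hYY : (X * E)ᴴ * (X * E) = Matrix.diagonal (fun i => ((hX.eigenvalues i : ℝ) : ℂ)) := by
    have h := hX.spectral_theorem
    rw [Unitary.conjStarAlgAut_apply] at h
    have h' : Xᴴ * X = E * Matrix.diagonal (fun i => ((hX.eigenvalues i : ℝ) : ℂ)) * Eᴴ := h
    rw [Matrix.conjTranspose_mul]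
    calc Eᴴ * Xᴴ * (X * E) = Eᴴ * (Xᴴ * X) * E := by simp only [Matrix.mul_assoc]
      _ = (Eᴴ * E) * Matrix.diagonal (fun i => ((hX.eigenvalues i : ℝ) : ℂ)) * (Eᴴ * E) := by
          generalize Matrix.diagonal (fun i => ((hX.eigenvalues i : ℝ) : ℂ)) = D at h' ⊢
          rw [h']; simp only [Matrix.mul_assoc]
      _ = _ := by rw [hEE']; simp
  set y : ι → EuclideanSpace ℂ ι := fun i => WithLp.toLp 2 fun k => (X * E) k i with hy
  have hin : ∀ i j, inner ℂ (y i) (y j) = if i = j then ((hX.eigenvalues i : ℝ) : ℂ) else 0 := by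
    intro i j
    have h := congrFun (congrFun hYY i) j
    rw [Matrix.diagonal_apply] at h
    rw [← h, EuclideanSpace.inner_eq_star_dotProduct, Matrix.mul_apply, dotProduct]
    exact Finset.sum_congr rfl fun k _ => mul_comm _ _
  have hsq : ∀ i, ((σ i : ℝ) : ℂ) * (σ i : ℝ) = ((hX.eigenvalues i : ℝ) : ℂ) := by
    intro i
    rw [← Complex.ofReal_mul, Real.mul_self_sqrt (hpos i)]
  obtain ⟨b, hb⟩ := Orthonormal.exists_orthonormalBasis_extension_of_card_eq (𝕜 := ℂ)
    (ι := ι) (E := EuclideanSpace ℂ ι) (by simp) (v := fun i => ((σ i : ℝ) : ℂ)⁻¹ • y i)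
    (s := {i | σ i ≠ 0})
    (by
      rw [orthonormal_iff_ite]
      rintro ⟨i, hi⟩ ⟨j, hj⟩
      have hi' : ((σ i : ℝ) : ℂ) ≠ 0 := by exact_mod_cast hi
      simp only [Set.domRestrict_apply, inner_smul_left, inner_smul_right, hin, Subtype.mk.injEq]
      split_ifs with hij
      · subst hij
        rw [← hsq i]
        simp [hi']
      · simp)
  refine ⟨_, matrix_orthonormalBasis_mem_unitary b, E, hX.eigenvectorUnitary.2, ?_⟩
  have hY : X * E = (Matrix.of fun k i => b i k) * Matrix.diagonal (fun i => ((σ i : ℝ) : ℂ)) := by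
    ext k i
    rw [Matrix.mul_diagonal]
    by_cases hi : σ i = 0
    · have h0 : y i = 0 := by
        rw [← inner_self_eq_zero (𝕜 := ℂ), hin, if_pos rfl, ← hsq i, hi]; simp
      have : y i k = 0 := by rw [h0]; rfl
      rw [hi]
      simpa [hy] using this
    · have hi' : ((σ i : ℝ) : ℂ) ≠ 0 := by exact_mod_cast hi
      rw [Matrix.of_apply, hb i hi]
      simp only [PiLp.smul_apply, smul_eq_mul, hy]
      field_simp
  rw [← hY, Matrix.mul_assoc, hEE, Matrix.mul_one]

lemma norm_entry_le {ι κ : Type*} [Fintype ι] [DecidableEq ι] [Fintype κ] [DecidableEq κ]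
    (M : Matrix ι κ ℂ) (i : ι) (j : κ) : ‖M i j‖ ≤ ‖M‖ := by
  have h := Matrix.l2_opNorm_mulVec M (EuclideanSpace.single j (1 : ℂ))
  have h2 := PiLp.norm_apply_le (WithLp.toLp 2 (M *ᵥ (Pi.single j (1 : ℂ)))) i
  simp only [PiLp.norm_single, norm_one, mul_one] at h
  refine le_trans ?_ (h2.trans h)
  simp

lemma norm_le_one_of_isometry {ι κ : Type*} [Fintype ι] [DecidableEq ι] [Fintype κ] [DecidableEq κ]
    {M : Matrix ι κ ℂ} (hM : Mᴴ * M = 1) : ‖M‖ ≤ 1 := by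
  have h := Matrix.l2_opNorm_conjTranspose_mul_self M
  rw [hM] at h
  have h1 : ‖(1 : Matrix κ κ ℂ)‖ ≤ 1 := by
    rw [← Matrix.diagonal_one, Matrix.l2_opNorm_diagonal]
    exact (pi_norm_le_iff_of_nonneg zero_le_one).2 fun i => by simp
  nlinarith [norm_nonneg M]

lemma traceNorm_nonneg {ι : Type} [Fintype ι] [DecidableEq ι] (X : Matrix ι ι ℂ) :
    0 ≤ traceNorm X := Finset.sum_nonneg fun _ _ => Real.sqrt_nonneg _

/-- Hölder's inequality for the operator norm and the trace norm. -/
theorem norm_trace_mul_le {ι : Type} [Fintype ι] [DecidableEq ι] (V X : Matrix ι ι ℂ) :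
    ‖(V * X).trace‖ ≤ ‖V‖ * traceNorm X := by
  obtain ⟨B, hB, E, hE, hX⟩ := exists_singularValueDecomposition X
  set σ := fun i => Real.sqrt ((Matrix.isHermitian_conjTranspose_mul_self X).eigenvalues i)
  have hB1 : ‖B‖ ≤ 1 := norm_le_one_of_isometry (Matrix.mem_unitaryGroup_iff'.mp hB)
  have hE1 : ‖Eᴴ‖ ≤ 1 := by
    rw [Matrix.l2_opNorm_conjTranspose]
    exact norm_le_one_of_isometry (Matrix.mem_unitaryGroup_iff'.mp hE)
  have hT : (V * X).trace = ∑ i, (Eᴴ * V * B) i i * (σ i : ℂ) := by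
    conv_lhs => rw [hX]
    rw [← Matrix.mul_assoc, Matrix.trace_mul_comm, ← Matrix.mul_assoc, ← Matrix.mul_assoc,
      Matrix.trace]
    simp [Matrix.mul_diagonal, σ]
  rw [hT, traceNorm, Finset.mul_sum]
  refine (norm_sum_le _ _).trans (Finset.sum_le_sum fun i _ => ?_)
  rw [norm_mul, Complex.norm_real, Real.norm_of_nonneg (Real.sqrt_nonneg _)]
  refine mul_le_mul_of_nonneg_right ((norm_entry_le _ i i).trans ?_) (Real.sqrt_nonneg _)
  calc ‖Eᴴ * V * B‖ ≤ ‖Eᴴ * V‖ * ‖B‖ := Matrix.l2_opNorm_mul _ _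
    _ ≤ ‖Eᴴ * V‖ * 1 := by gcongr
    _ ≤ (‖Eᴴ‖ * ‖V‖) * 1 := by gcongr; exact Matrix.l2_opNorm_mul _ _
    _ ≤ (1 * ‖V‖) * 1 := by gcongr
    _ = ‖V‖ := by ring

/-- The trace norm is attained as the trace against a unitary. With `norm_trace_mul_le` this is the
duality that replaces a triangle inequality for the trace norm. -/
theorem exists_unitary_trace_mul_eq {ι : Type} [Fintype ι] [DecidableEq ι] (X : Matrix ι ι ℂ) :
    ∃ V ∈ Matrix.unitaryGroup ι ℂ, (V * X).trace = (traceNorm X : ℂ) := by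
  obtain ⟨B, hB, E, hE, hX⟩ := exists_singularValueDecomposition X
  refine ⟨E * Bᴴ, mul_mem hE (Unitary.star_mem hB), ?_⟩
  have hB' : Bᴴ * B = 1 := Matrix.mem_unitaryGroup_iff'.mp hB
  have hE' : Eᴴ * E = 1 := Matrix.mem_unitaryGroup_iff'.mp hE
  set σ := fun i => Real.sqrt ((Matrix.isHermitian_conjTranspose_mul_self X).eigenvalues i)
  have h : E * Bᴴ * X = E * Matrix.diagonal (fun i => (σ i : ℂ)) * Eᴴ := by
    conv_lhs => rw [hX]
    calc _ = E * (Bᴴ * B) * Matrix.diagonal (fun i => (σ i : ℂ)) * Eᴴ := by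
          simp only [Matrix.mul_assoc, σ]
      _ = _ := by rw [hB', Matrix.mul_one]
  rw [h, Matrix.trace_mul_comm, ← Matrix.mul_assoc, hE', Matrix.one_mul, traceNorm,
    Matrix.trace_diagonal]
  simp [σ]

/-- The column of blocks `M x`: the operator `ψ ↦ ∑ x, |x⟩ ⊗ M x ψ` attached to a Kraus family. -/
def stack {A ι : Type} (M : A → Matrix ι ι ℂ) : Matrix (A × ι) ι ℂ :=
  Matrix.of fun p j => M p.1 p.2 j

lemma stack_sub {A ι : Type} (M J : A → Matrix ι ι ℂ) :
    stack (fun x => M x - J x) = stack M - stack J := by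
  ext; simp [stack]

lemma stack_conjTranspose_mul {A ι : Type} [Fintype A] [Fintype ι] (M J : A → Matrix ι ι ℂ) :
    (stack M)ᴴ * stack J = ∑ x, (M x)ᴴ * J x := by
  ext i j
  simp [stack, Matrix.mul_apply, Matrix.sum_apply, Fintype.sum_prod_type]

lemma one_kronecker_mul_stack {A ι : Type} [Fintype A] [DecidableEq A] [Fintype ι]
    (V : Matrix ι ι ℂ) (M : A → Matrix ι ι ℂ) :
    ((1 : Matrix A A ℂ) ⊗ₖ V) * stack M = stack fun x => V * M x := by
  ext ⟨x, i⟩ j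
  simp [stack, Matrix.mul_apply, Fintype.sum_prod_type, Matrix.one_apply, Finset.sum_ite_eq]

/-- Channels whose Stinespring isometries are close are close: if `V` attains the trace norm of the
difference, that trace norm is the trace of `(M†(1 ⊗ V)M - J†(1 ⊗ V)J) X`, where `M` and `J` are the
stacked Kraus operators. -/
theorem traceNorm_kraus_sub_le {A ι : Type} [Fintype A] [DecidableEq A] [Fintype ι] [DecidableEq ι]
    (M J : A → Matrix ι ι ℂ) {δ : ℝ} (hM : ∑ x, (M x)ᴴ * M x = 1) (hJ : ∑ x, (J x)ᴴ * J x = 1)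
    (hδ : ‖stack M - stack J‖ ≤ δ) (X : Matrix ι ι ℂ) :
    traceNorm (∑ x, (M x * X * (M x)ᴴ - J x * X * (J x)ᴴ)) ≤ 2 * δ * traceNorm X := by
  obtain ⟨V, hV, hVX⟩ := exists_unitary_trace_mul_eq
    (∑ x, (M x * X * (M x)ᴴ - J x * X * (J x)ᴴ))
  have hM1 : ‖stack M‖ ≤ 1 := norm_le_one_of_isometry (by rw [stack_conjTranspose_mul, hM])
  have hJ1 : ‖stack J‖ ≤ 1 := norm_le_one_of_isometry (by rw [stack_conjTranspose_mul, hJ])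
  have hV1 : ‖(1 : Matrix A A ℂ) ⊗ₖ V‖ ≤ 1 := by
    refine norm_le_one_of_isometry ?_
    have hV' : Vᴴ * V = 1 := Matrix.mem_unitaryGroup_iff'.mp hV
    rw [Matrix.conjTranspose_kronecker, ← Matrix.mul_kronecker_mul, hV']
    simp
  set S := (1 : Matrix A A ℂ) ⊗ₖ V
  have key : (V * ∑ x, (M x * X * (M x)ᴴ - J x * X * (J x)ᴴ)).trace =
      (((stack M)ᴴ * (S * (stack M - stack J)) + (stack M - stack J)ᴴ * (S * stack J)) * X).trace := by
    rw [← stack_sub, one_kronecker_mul_stack, one_kronecker_mul_stack, stack_conjTranspose_mul,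
      stack_conjTranspose_mul, ← Finset.sum_add_distrib, Finset.sum_mul, Finset.mul_sum,
      Matrix.trace_sum, Matrix.trace_sum]
    refine Finset.sum_congr rfl fun x _ => ?_
    have e1 : (V * (M x * X * (M x)ᴴ)).trace = ((M x)ᴴ * (V * M x) * X).trace := by
      rw [show V * (M x * X * (M x)ᴴ) = (V * M x * X) * (M x)ᴴ by simp only [Matrix.mul_assoc],
        Matrix.trace_mul_comm]
      simp only [Matrix.mul_assoc]
    have e2 : (V * (J x * X * (J x)ᴴ)).trace = ((J x)ᴴ * (V * J x) * X).trace := by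
      rw [show V * (J x * X * (J x)ᴴ) = (V * J x * X) * (J x)ᴴ by simp only [Matrix.mul_assoc],
        Matrix.trace_mul_comm]
      simp only [Matrix.mul_assoc]
    rw [Matrix.mul_sub, Matrix.trace_sub, e1, e2, ← Matrix.trace_sub, ← Matrix.sub_mul]
    congr 2
    rw [Matrix.conjTranspose_sub]
    noncomm_ring
  have hb := norm_trace_mul_le
    ((stack M)ᴴ * (S * (stack M - stack J)) + (stack M - stack J)ᴴ * (S * stack J)) X
  rw [← key, hVX, Complex.norm_real, Real.norm_of_nonneg (traceNorm_nonneg _)] at hb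
  refine hb.trans (mul_le_mul_of_nonneg_right ?_ (traceNorm_nonneg X))
  have hδ0 : 0 ≤ δ := (norm_nonneg _).trans hδ
  have b1 : ‖(stack M)ᴴ * (S * (stack M - stack J))‖ ≤ 1 * (1 * δ) := by
    refine (Matrix.l2_opNorm_mul _ _).trans ?_
    rw [Matrix.l2_opNorm_conjTranspose]
    gcongr
    exact (Matrix.l2_opNorm_mul _ _).trans (by gcongr)
  have b2 : ‖(stack M - stack J)ᴴ * (S * stack J)‖ ≤ δ * (1 * 1) := by
    refine (Matrix.l2_opNorm_mul _ _).trans ?_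
    rw [Matrix.l2_opNorm_conjTranspose]
    gcongr
    exact (Matrix.l2_opNorm_mul _ _).trans (by gcongr)
  calc _ ≤ _ := norm_add_le _ _
    _ ≤ 2 * δ := by linarith

/-- `M ↦ M ⊗ 1` as a homomorphism of star algebras. -/
def kroneckerOneHom (ι κ : Type) [Fintype ι] [DecidableEq ι] [Fintype κ] [DecidableEq κ] :
    Matrix ι ι ℂ →⋆ₐ[ℂ] Matrix (ι × κ) (ι × κ) ℂ where
  toFun M := M ⊗ₖ 1
  map_one' := by simp
  map_mul' M N := by rw [← Matrix.mul_kronecker_mul, Matrix.mul_one]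
  map_zero' := by simp
  map_add' M N := Matrix.add_kronecker _ _ _
  commutes' c := by
    rw [Algebra.algebraMap_eq_smul_one, Algebra.algebraMap_eq_smul_one, Matrix.smul_kronecker]
    simp
  map_star' M := by
    simp [Matrix.star_eq_conjTranspose, Matrix.conjTranspose_kronecker]

/-- Homomorphisms of C⋆-algebras are contractive; hence ampliation by a reference system does not
increase norms. -/
lemma norm_kronecker_one_le {ι κ : Type} [Fintype ι] [DecidableEq ι] [Fintype κ] [DecidableEq κ]
    (M : Matrix ι ι ℂ) : ‖M ⊗ₖ (1 : Matrix κ κ ℂ)‖ ≤ ‖M‖ :=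
  NonUnitalStarAlgHom.norm_apply_le (kroneckerOneHom ι κ) M

/-- The Kraus operator of `dilated C a` for the final state `x` of the ancilla. -/
def krausOp {B A : Type} (C : Matrix (B × A) (B × A) ℂ) (a x : A) : Matrix B B ℂ :=
  C.submatrix (fun i => (i, x)) (fun i => (i, a))

lemma dilated_apply_eq_sum {B A : Type} [Fintype B] [Fintype A] [DecidableEq A]
    (C : Matrix (B × A) (B × A) ℂ) (a : A) (ρ : Matrix B B ℂ) :
    dilated C a ρ = ∑ x, krausOp C a x * ρ * (krausOp C a x)ᴴ := by
  ext i j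
  simp only [dilated, LinearMap.coe_mk, AddHom.coe_mk, Matrix.of_apply, Matrix.sum_apply]
  refine Finset.sum_congr rfl fun x _ => ?_
  simp only [Matrix.mul_apply, Fintype.sum_prod_type, Matrix.kroneckerMap_apply,
    Matrix.single_apply, krausOp, Matrix.submatrix_apply, Matrix.conjTranspose_apply]
  refine Finset.sum_congr rfl fun j' _ => ?_
  rw [Finset.sum_eq_single a]
  · congr 1
    refine Finset.sum_congr rfl fun i' _ => ?_
    rw [Finset.sum_eq_single a]
    · simp
    · intro b _ hb; simp [Ne.symm hb]
    · simp
  · intro b _ hb; simp [Ne.symm hb]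
  · simp

lemma kronecker_one_conj_apply {B : Type} [Fintype B] (k : ℕ) (N : Matrix B B ℂ)
    (X : Matrix (B × Fin k) (B × Fin k) ℂ) (i j : B) (r s : Fin k) :
    ((N ⊗ₖ (1 : Matrix (Fin k) (Fin k) ℂ)) * X * (N ⊗ₖ (1 : Matrix (Fin k) (Fin k) ℂ))ᴴ)
      (i, r) (j, s) = (N * (Matrix.of fun i j => X (i, r) (j, s)) * Nᴴ) i j := by
  simp [Matrix.mul_apply, Fintype.sum_prod_type, Matrix.one_apply, Matrix.conjTranspose_apply,
    apply_ite (starRingEnd ℂ)]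

lemma ampliate_sub_eq_sum {B A : Type} [Fintype B] [DecidableEq B] [Fintype A] [DecidableEq A]
    (C : Matrix (B × A) (B × A) ℂ) (a : A) (u : Matrix B B ℂ) (k : ℕ)
    (X : Matrix (B × Fin k) (B × Fin k) ℂ) :
    ampliate k (dilated C a - conjBy u) X =
      ∑ x, ((krausOp C a x ⊗ₖ 1) * X * (krausOp C a x ⊗ₖ 1)ᴴ -
        ((if x = a then u else 0) ⊗ₖ 1) * X * ((if x = a then u else 0) ⊗ₖ 1)ᴴ) := by
  have hu : ∀ ρ, conjBy u ρ = ∑ x, (if x = a then u else 0) * ρ * (if x = a then u else 0)ᴴ := by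
    intro ρ
    rw [Finset.sum_eq_single a] <;> simp +contextual [conjBy]
  ext ⟨i, r⟩ ⟨j, s⟩
  simp only [ampliate, Matrix.of_apply, LinearMap.sub_apply, dilated_apply_eq_sum, hu,
    Matrix.sum_apply, Matrix.sub_apply, kronecker_one_conj_apply, Finset.sum_sub_distrib]

/-- If the diagonal block of a unitary `C` at the ancilla state `a` is `δ`-close to a unitary `u`, then
the remaining blocks are automatically small, of order `√δ`, and discarding the ancilla after `C`
comes within `2 * √(2 * δ)` of conjugation by `u`. -/
theorem diamondNorm_dilated_sub_conjBy_le {B A : Type} [Fintype B] [DecidableEq B] [Fintype A]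
    [DecidableEq A] {C : Matrix (B × A) (B × A) ℂ} (hC : Cᴴ * C = 1) (a : A) {u : Matrix B B ℂ}
    (hu : uᴴ * u = 1) {δ : ℝ} (hδ : ‖krausOp C a a - u‖ ≤ δ) :
    diamondNorm (dilated C a - conjBy u) ≤ ENNReal.ofReal (2 * Real.sqrt (2 * δ)) := by
  refine iSup_le fun k => iSup_le fun X => iSup_le fun hX => ENNReal.ofReal_le_ofReal ?_
  rw [ampliate_sub_eq_sum]
  set M : A → Matrix (B × Fin k) (B × Fin k) ℂ := fun x => krausOp C a x ⊗ₖ 1 with hM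
  set J : A → Matrix (B × Fin k) (B × Fin k) ℂ := fun x => (if x = a then u else 0) ⊗ₖ 1 with hJ
  have hMM : ∑ x, (M x)ᴴ * M x = 1 := by
    have h1 : ∑ x, (krausOp C a x)ᴴ * krausOp C a x = 1 := by
      ext i j
      have h := congrFun (congrFun hC (i, a)) (j, a)
      rw [Matrix.mul_apply, Fintype.sum_prod_type, Finset.sum_comm] at h
      simpa [Matrix.sum_apply, Matrix.mul_apply, krausOp, Matrix.one_apply] using h
    have h2 := congrArg (kroneckerOneHom B (Fin k)) h1
    rw [map_sum, map_one] at h2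
    rw [← h2]
    refine Finset.sum_congr rfl fun x _ => ?_
    rw [map_mul, ← Matrix.star_eq_conjTranspose, ← Matrix.star_eq_conjTranspose, map_star]
    rfl
  have hu2 : (u ⊗ₖ (1 : Matrix (Fin k) (Fin k) ℂ))ᴴ * (u ⊗ₖ 1) = 1 := by
    rw [Matrix.conjTranspose_kronecker, ← Matrix.mul_kronecker_mul, hu]; simp
  have hJa : ∀ x, J x = if x = a then u ⊗ₖ 1 else 0 := by
    intro x; simp only [hJ]; split_ifs <;> simp
  have hJJ : ∑ x, (J x)ᴴ * J x = 1 := by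
    rw [Finset.sum_eq_single a]
    · rw [hJa, if_pos rfl, hu2]
    · intro x _ hx; rw [hJa, if_neg hx]; simp
    · simp
  have hMJ : ∑ x, (M x)ᴴ * J x = (M a)ᴴ * (u ⊗ₖ 1) := by
    rw [Finset.sum_eq_single a]
    · rw [hJa, if_pos rfl]
    · intro x _ hx; rw [hJa, if_neg hx]; simp
    · simp
  have hJM : ∑ x, (J x)ᴴ * M x = (u ⊗ₖ 1)ᴴ * M a := by
    rw [Finset.sum_eq_single a]
    · rw [hJa, if_pos rfl]
    · intro x _ hx; rw [hJa, if_neg hx]; simp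
    · simp
  set uk := u ⊗ₖ (1 : Matrix (Fin k) (Fin k) ℂ) with huk
  have hd : ‖M a - uk‖ ≤ δ := by
    have : M a - uk = (krausOp C a a - u) ⊗ₖ 1 := by
      rw [sub_eq_add_neg, ← neg_one_smul ℂ uk, sub_eq_add_neg, ← neg_one_smul ℂ u,
        Matrix.add_kronecker, Matrix.smul_kronecker]
    rw [this]
    exact (norm_kronecker_one_le _).trans hδ
  have huk1 : ‖uk‖ ≤ 1 := norm_le_one_of_isometry hu2
  have hδ0 : 0 ≤ δ := (norm_nonneg _).trans hδ
  have hnorm : ‖stack M - stack J‖ ≤ Real.sqrt (2 * δ) := by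
    apply Real.le_sqrt_of_sq_le
    rw [sq, ← Matrix.l2_opNorm_conjTranspose_mul_self]
    -- Since both stacks are isometries, only the block at `a` enters the difference.
    have e : (stack M - stack J)ᴴ * (stack M - stack J) =
        ukᴴ * (uk - M a) + (uk - M a)ᴴ * uk := by
      rw [Matrix.conjTranspose_sub, Matrix.sub_mul, Matrix.mul_sub, Matrix.mul_sub,
        stack_conjTranspose_mul, stack_conjTranspose_mul, stack_conjTranspose_mul,
        stack_conjTranspose_mul, hMM, hJJ, hMJ, hJM, Matrix.mul_sub, Matrix.conjTranspose_sub,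
        Matrix.sub_mul, hu2]
      abel
    rw [e]
    have b1 : ‖ukᴴ * (uk - M a)‖ ≤ 1 * δ := by
      refine (Matrix.l2_opNorm_mul _ _).trans ?_
      rw [Matrix.l2_opNorm_conjTranspose, norm_sub_rev]
      gcongr
    have b2 : ‖(uk - M a)ᴴ * uk‖ ≤ δ * 1 := by
      refine (Matrix.l2_opNorm_mul _ _).trans ?_
      rw [Matrix.l2_opNorm_conjTranspose, norm_sub_rev]
      gcongr
    calc _ ≤ _ := norm_add_le _ _
      _ ≤ 2 * δ := by linarith
  refine (traceNorm_kraus_sub_le M J hMM hJJ hnorm X).trans ?_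
  calc _ ≤ 2 * Real.sqrt (2 * δ) * 1 := by gcongr
    _ = _ := mul_one _

end

/-! ### Factorization of vector polynomials of norm one on the circle -/

/-- A projection that fixes `y` and annihilates the orthogonal vector `x`. It is the projection onto
the line of `y`, or zero if `y = 0`. -/
lemma exists_projection_separating {ι : Type} [Fintype ι] [DecidableEq ι] (x y : ι → ℂ)
    (hxy : star x ⬝ᵥ y = 0) :
    ∃ P : Matrix ι ι ℂ, Pᴴ = P ∧ P * P = P ∧ P *ᵥ y = y ∧ P *ᵥ x = 0 := by
  by_cases hy : star y ⬝ᵥ y = 0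
  · refine ⟨0, by simp, by simp, ?_, by simp⟩
    have : y = 0 := by
      rw [dotProduct] at hy
      funext i
      have h : ∑ i, ‖y i‖ ^ 2 = 0 := by
        have h2 : ((∑ i, ‖y i‖ ^ 2 : ℝ) : ℂ) = 0 := by
          rw [← hy]; push_cast
          exact Finset.sum_congr rfl fun i _ => by simp [← Complex.conj_mul']
        exact_mod_cast h2
      have := (Finset.sum_eq_zero_iff_of_nonneg (fun i _ => by positivity)).1 h i (Finset.mem_univ i)
      simpa using this
    simp [this]
  · set c := star y ⬝ᵥ y with hc
    have hcs : star c = c := (Matrix.star_dotProduct y y).symm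
    refine ⟨c⁻¹ • Matrix.vecMulVec y (star y), ?_, ?_, ?_, ?_⟩
    · rw [Matrix.conjTranspose_smul, Matrix.conjTranspose_vecMulVec, star_star, star_inv₀, hcs]
    · rw [Matrix.smul_mul, Matrix.mul_smul, Matrix.vecMulVec_mul_vecMulVec, ← hc,
        Matrix.vecMulVec_smul, smul_smul c⁻¹ c, inv_mul_cancel₀ hy, one_smul]
    · rw [Matrix.smul_mulVec, Matrix.vecMulVec_mulVec, ← hc]
      ext i
      simp [mul_comm, hy]
    · have : star y ⬝ᵥ x = 0 := by
        have := congrArg star hxy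
        rwa [Matrix.star_dotProduct, star_star, star_zero] at this
      rw [Matrix.smul_mulVec, Matrix.vecMulVec_mulVec, this]
      simp

/-- The vector polynomial `∑ k ≤ L, z ^ k • v k` has norm one on the unit circle, expressed through
the Fourier coefficients of its squared norm. -/
def UnitOnCircle {ι : Type} [Fintype ι] (L : ℕ) (v : ℕ → ι → ℂ) : Prop :=
  (∀ k, L < k → v k = 0) ∧
    ∀ l, ∑ k ∈ Finset.range (L + 1), star (v k) ⬝ᵥ v (k + l) = if l = 0 then 1 else 0

/-- Degree reduction. The extreme coefficients are orthogonal because the Fourier coefficient of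
frequency `L + 1` vanishes, so `z⁻¹ P + (1 - P)` maps the polynomial to one of smaller degree, and it
is unitary on the circle. -/
lemma UnitOnCircle.exists_peel {ι : Type} [Fintype ι] [DecidableEq ι] {L : ℕ} {v : ℕ → ι → ℂ}
    (hv : UnitOnCircle (L + 1) v) :
    ∃ P : Matrix ι ι ℂ, Pᴴ = P ∧ P * P = P ∧ P *ᵥ v (L + 1) = v (L + 1) ∧ P *ᵥ v 0 = 0 ∧
      UnitOnCircle L fun k => P *ᵥ v (k + 1) + (1 - P) *ᵥ v k := by
  obtain ⟨hs, ha⟩ := hv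
  have h0 : star (v 0) ⬝ᵥ v (L + 1) = 0 := by
    have h := ha (L + 1)
    rw [if_neg (Nat.succ_ne_zero L), Finset.sum_eq_single 0] at h
    · simpa using h
    · intro k _ hk
      rw [hs (k + (L + 1)) (by omega)]; simp
    · simp
  obtain ⟨P, hP, hPP, hy, hx⟩ := exists_projection_separating _ _ h0
  refine ⟨P, hP, hPP, hy, hx, ?_, ?_⟩
  · intro k hk
    simp only
    rw [hs (k + 1) (by omega)]
    rcases Nat.eq_or_lt_of_le (Nat.succ_le_of_lt hk) with h | h
    · rw [← h, Matrix.sub_mulVec, hy]; simp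
    · rw [hs k h]; simp
  · intro l
    have adj : ∀ a b : ι → ℂ, star (P *ᵥ a) ⬝ᵥ b = star a ⬝ᵥ (P *ᵥ b) := by
      intro a b
      rw [Matrix.star_mulVec, hP, Matrix.dotProduct_mulVec]
    have hterm : ∀ a b c d : ι → ℂ, star (P *ᵥ a + (1 - P) *ᵥ b) ⬝ᵥ (P *ᵥ c + (1 - P) *ᵥ d) =
        star a ⬝ᵥ (P *ᵥ c) + star b ⬝ᵥ ((1 - P) *ᵥ d) := by
      intro a b c d
      simp only [Matrix.sub_mulVec, Matrix.one_mulVec, star_add, star_sub, add_dotProduct,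
        sub_dotProduct, dotProduct_add, dotProduct_sub, adj, Matrix.mulVec_mulVec, hPP]
      ring
    simp only [hterm]
    rw [Finset.sum_add_distrib]
    have e1 : ∑ k ∈ Finset.range (L + 1), star (v (k + 1)) ⬝ᵥ (P *ᵥ v (k + l + 1)) =
        ∑ k ∈ Finset.range (L + 1 + 1), star (v k) ⬝ᵥ (P *ᵥ v (k + l)) := by
      rw [Finset.sum_range_succ' _ (L + 1), ← adj (v 0), hx]
      simp [add_right_comm]
    have e2 : ∑ k ∈ Finset.range (L + 1), star (v k) ⬝ᵥ ((1 - P) *ᵥ v (k + l)) =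
        ∑ k ∈ Finset.range (L + 1 + 1), star (v k) ⬝ᵥ ((1 - P) *ᵥ v (k + l)) := by
      rw [Finset.sum_range_succ _ (L + 1), Matrix.sub_mulVec, Matrix.one_mulVec, dotProduct_sub,
        ← adj, hy]
      simp
    rw [e1, e2, ← Finset.sum_add_distrib, ← ha l]
    refine Finset.sum_congr rfl fun k _ => ?_
    rw [← dotProduct_add, Matrix.sub_mulVec]
    simp

/-- A vector polynomial of norm one on the circle is a product of factors `z P + (1 - P)`, with
orthogonal projections `P`, applied to a constant unit vector. The identity is stated with the
variable replaced by any ring element `W` that commutes with the image of the matrices, which is how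
`W`, applied under control of the projections, implements the polynomial. -/
theorem UnitOnCircle.exists_factorization {ι : Type} [Fintype ι] [DecidableEq ι] (e : ι → ℂ)
    (L : ℕ) : ∀ (v : ℕ → ι → ℂ), UnitOnCircle L v →
      ∃ (Ps : List (Matrix ι ι ℂ)) (u : ι → ℂ), Ps.length = L ∧ (∀ P ∈ Ps, Pᴴ = P ∧ P * P = P) ∧
        ∑ i, ‖u i‖ ^ 2 = 1 ∧
        ∀ {R : Type} [Ring R] (π : Matrix ι ι ℂ →+* R) (W : R), (∀ m, Commute (π m) W) →
          (Ps.map fun P => π P * W + (1 - π P)).prod * π (Matrix.vecMulVec u e) =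
            ∑ k ∈ Finset.range (L + 1), W ^ k * π (Matrix.vecMulVec (v k) e) := by
  induction L with
  | zero =>
    intro v hv
    refine ⟨[], v 0, rfl, by simp, ?_, ?_⟩
    · have h := hv.2 0
      simp only [zero_add, Finset.range_one, Finset.sum_singleton, if_true, dotProduct] at h
      have h2 : ((∑ i, ‖v 0 i‖ ^ 2 : ℝ) : ℂ) = 1 := by
        rw [← h]; push_cast
        exact Finset.sum_congr rfl fun i _ => by simp [← Complex.conj_mul']
      exact_mod_cast h2
    · intro R _ π W _
      simp
  | succ L ih =>
    intro v hv
    obtain ⟨P, hP, hPP, hy, hx, hv'⟩ := hv.exists_peel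
    obtain ⟨Ps, u, hlen, hPs, hu, hfac⟩ := ih _ hv'
    refine ⟨P :: Ps, u, by simp [hlen], ?_, hu, ?_⟩
    · intro Q hQ
      rcases List.mem_cons.1 hQ with rfl | hQ
      · exact ⟨hP, hPP⟩
      · exact hPs Q hQ
    · intro R _ π W hW
      rw [List.map_cons, List.prod_cons, mul_assoc, hfac π W hW]
      have hPW : ∀ k, π P * W ^ k = W ^ k * π P := fun k => (hW P).pow_right k
      have hcol : ∀ x : ι → ℂ, π P * π (Matrix.vecMulVec x e) =
          π (Matrix.vecMulVec (P *ᵥ x) e) := by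
        intro x; rw [← map_mul, Matrix.mul_vecMulVec]
      have hcol' : ∀ x : ι → ℂ, (1 - π P) * π (Matrix.vecMulVec x e) =
          π (Matrix.vecMulVec ((1 - P) *ᵥ x) e) := by
        intro x; rw [← map_one π, ← map_sub, ← map_mul, Matrix.mul_vecMulVec]
      have q1 : ∀ a b : ι → ℂ, P *ᵥ (P *ᵥ a + (1 - P) *ᵥ b) = P *ᵥ a := by
        intro a b
        simp [Matrix.mulVec_add, Matrix.sub_mulVec, Matrix.mulVec_sub, Matrix.mulVec_mulVec, hPP]
      have q2 : ∀ a b : ι → ℂ, (1 - P) *ᵥ (P *ᵥ a + (1 - P) *ᵥ b) = (1 - P) *ᵥ b := by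
        intro a b
        simp [Matrix.mulVec_add, Matrix.mulVec_mulVec, Matrix.sub_mul, Matrix.mul_sub, hPP]
      have s1 : π P * W * ∑ k ∈ Finset.range (L + 1), W ^ k *
            π (Matrix.vecMulVec (P *ᵥ v (k + 1) + (1 - P) *ᵥ v k) e) =
          ∑ k ∈ Finset.range (L + 1 + 1), W ^ k * π (Matrix.vecMulVec (P *ᵥ v k) e) := by
        rw [Finset.sum_range_succ' _ (L + 1), hx, Finset.mul_sum]
        simp only [Matrix.zero_vecMulVec, map_zero, mul_zero, add_zero]
        refine Finset.sum_congr rfl fun k _ => ?_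
        rw [← mul_assoc, mul_assoc (π P), ← pow_succ', hPW, mul_assoc, hcol, q1]
      have s2 : (1 - π P) * ∑ k ∈ Finset.range (L + 1), W ^ k *
            π (Matrix.vecMulVec (P *ᵥ v (k + 1) + (1 - P) *ᵥ v k) e) =
          ∑ k ∈ Finset.range (L + 1 + 1), W ^ k * π (Matrix.vecMulVec ((1 - P) *ᵥ v k) e) := by
        have hz : (1 - P) *ᵥ v (L + 1) = 0 := by rw [Matrix.sub_mulVec, hy]; simp
        rw [Finset.sum_range_succ _ (L + 1), hz, Finset.mul_sum]
        simp only [Matrix.zero_vecMulVec, map_zero, mul_zero, add_zero]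
        refine Finset.sum_congr rfl fun k _ => ?_
        have : (1 - π P) * W ^ k = W ^ k * (1 - π P) := by
          rw [sub_mul, mul_sub, hPW]; simp
        rw [← mul_assoc, this, mul_assoc, hcol', q2]
      rw [add_mul, s1, s2, ← Finset.sum_add_distrib]
      refine Finset.sum_congr rfl fun k _ => ?_
      rw [← mul_add, ← map_add, ← Matrix.add_vecMulVec, ← Matrix.add_mulVec]
      simp

/-! ### Completion of the truncated exponential to a vector of constant norm -/

section

open Polynomial Finset

section Completion

/-- The `l`-th autocorrelation of the sequence `c`, i.e. the `l`-th Fourier coefficient of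
`‖∑ k ≤ L, c k * z ^ k‖ ^ 2` on the unit circle. -/
def autocorr (L : ℕ) (c : ℕ → ℂ) (l : ℕ) : ℂ := ∑ k ∈ range (L + 1), star (c k) * c (k + l)

/-- An upper bound for `‖∑ k ≤ L, c k * z ^ k‖ ^ 2` on the unit circle. -/
def completionBound (L : ℕ) (c : ℕ → ℂ) : ℝ :=
  ∑ k ∈ range (L + 1), ‖c k‖ ^ 2 + 2 * ∑ l ∈ range L, ‖autocorr L c (l + 1)‖

/-- Component `0` is `c`; component `l ≥ 1` is a binomial `a + b * z ^ l` whose squared modulus has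
Fourier coefficient `-autocorr L c l` at frequency `l`. -/
def binomialCompletion (L : ℕ) (c : ℕ → ℂ) (k : ℕ) : Fin (L + 1) → ℂ :=
  Fin.cons (c k) fun l =>
    if k = 0 then (Real.sqrt ‖autocorr L c (l + 1)‖ : ℂ)
    else if k = l + 1 then -autocorr L c (l + 1) / (Real.sqrt ‖autocorr L c (l + 1)‖ : ℂ) else 0

/-- The autocorrelation of `a + b * z ^ (i + 1)`. -/
lemma sum_binomial {L i : ℕ} (hi : i < L) (a b : ℂ) (l : ℕ) :
    ∑ k ∈ range (L + 1), star (if k = 0 then a else if k = i + 1 then b else 0) *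
        (if k + l = 0 then a else if k + l = i + 1 then b else 0) =
      if l = 0 then star a * a + star b * b else if l = i + 1 then star a * b else 0 := by
  rw [← Finset.sum_subset (s₁ := {0, i + 1})]
  · rw [Finset.sum_pair (by omega)]
    rcases Nat.eq_zero_or_pos l with rfl | hl
    · simp
    · have h1 : l ≠ 0 := hl.ne'
      simp [h1]
  · intro k hk
    simp only [mem_insert, mem_singleton] at hk
    simp only [mem_range]; omega
  · intro k _ hk
    simp only [mem_insert, mem_singleton, not_or] at hk
    simp [hk.1, hk.2]

/-- Any polynomial can be completed, without a spectral factorization, to a vector polynomial of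
constant norm on the circle: the nonconstant Fourier modes of its squared modulus are cancelled one by
one by those of binomials. -/
theorem unitOnCircle_binomialCompletion {L : ℕ} {c : ℕ → ℂ} (hc : ∀ k, L < k → c k = 0)
    (hN : 0 < completionBound L c) :
    UnitOnCircle L fun k =>
      ((Real.sqrt (completionBound L c) : ℝ) : ℂ)⁻¹ • binomialCompletion L c k := by
  set N := completionBound L c with hNdef
  have hsN : ((Real.sqrt N : ℝ) : ℂ)⁻¹ * ((Real.sqrt N : ℝ) : ℂ)⁻¹ = (N : ℂ)⁻¹ := by
    rw [← mul_inv, ← Complex.ofReal_mul, Real.mul_self_sqrt hN.le]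
  constructor
  · intro k hk
    have : binomialCompletion L c k = 0 := by
      ext i
      refine Fin.cases ?_ (fun l => ?_) i
      · simpa [binomialCompletion] using hc k hk
      · have h1 : k ≠ 0 := by omega
        have h2 : k ≠ l + 1 := by omega
        simp [binomialCompletion, h1, h2]
    simp only [this, smul_zero]
  · intro l
    have key : ∑ k ∈ range (L + 1),
        star (binomialCompletion L c k) ⬝ᵥ binomialCompletion L c (k + l) =
          if l = 0 then (N : ℂ) else 0 := by
      have hsq : ∀ x : ℂ, ((Real.sqrt ‖x‖ : ℝ) : ℂ) * ((Real.sqrt ‖x‖ : ℝ) : ℂ) = (‖x‖ : ℂ) := by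
        intro x; rw [← Complex.ofReal_mul, Real.mul_self_sqrt (norm_nonneg x)]
      simp only [dotProduct, Fin.sum_univ_succ, binomialCompletion, Pi.star_apply, Fin.cons_zero,
        Fin.cons_succ]
      rw [sum_add_distrib, sum_comm]
      simp only [sum_binomial (Fin.is_lt _)]
      have hab : ∀ x : ℂ, star ((Real.sqrt ‖x‖ : ℝ) : ℂ) * (-x / ((Real.sqrt ‖x‖ : ℝ) : ℂ)) = -x := by
        intro x
        by_cases hx : x = 0
        · simp [hx]
        · have : ((Real.sqrt ‖x‖ : ℝ) : ℂ) ≠ 0 := by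
            exact_mod_cast (Real.sqrt_pos.2 (norm_pos_iff.2 hx)).ne'
          rw [Complex.star_def, Complex.conj_ofReal]
          field_simp
      have haa : ∀ x : ℂ, star ((Real.sqrt ‖x‖ : ℝ) : ℂ) * ((Real.sqrt ‖x‖ : ℝ) : ℂ) +
          star (-x / ((Real.sqrt ‖x‖ : ℝ) : ℂ)) * (-x / ((Real.sqrt ‖x‖ : ℝ) : ℂ)) =
            2 * (‖x‖ : ℂ) := by
        intro x
        by_cases hx : x = 0
        · simp [hx]
        · have h0 : ((‖x‖ : ℝ) : ℂ) ≠ 0 := by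
            exact_mod_cast (norm_pos_iff.2 hx).ne'
          rw [Complex.star_def, Complex.conj_ofReal, hsq, map_div₀, Complex.conj_ofReal,
            div_mul_div_comm, hsq, map_neg, neg_mul_neg, Complex.conj_mul', sq,
            mul_div_assoc, div_self h0]
          ring
      simp only [hab, haa]
      rcases Nat.eq_zero_or_pos l with rfl | hl
      · simp only [if_true, add_zero]
        rw [hNdef, completionBound, Fin.sum_univ_eq_sum_range
          (fun l => 2 * ((‖autocorr L c (l + 1)‖ : ℝ) : ℂ))]
        push_cast
        rw [mul_sum]
        congr 1
        exact sum_congr rfl fun k _ => by rw [← Complex.conj_mul']; rfl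
      · have h0 : l ≠ 0 := hl.ne'
        simp only [h0, if_false]
        change autocorr L c l + _ = 0
        by_cases hlL : l ≤ L
        · rw [Fin.sum_univ_eq_sum_range
            (fun i => if l = i + 1 then -autocorr L c (i + 1) else 0),
            sum_eq_single (l - 1)]
          · simp [Nat.sub_add_cancel hl]
          · intro b _ hb
            rw [if_neg (by omega)]
          · intro h
            simp only [mem_range] at h; omega
        · rw [autocorr, sum_eq_zero, sum_eq_zero, add_zero]
          · intro i _
            have := i.is_lt
            rw [if_neg (by omega)]
          · intro k _
            rw [hc (k + l) (by omega), mul_zero]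
    have : ∀ a b : Fin (L + 1) → ℂ, star (((Real.sqrt N : ℝ) : ℂ)⁻¹ • a) ⬝ᵥ
        (((Real.sqrt N : ℝ) : ℂ)⁻¹ • b) = (N : ℂ)⁻¹ * (star a ⬝ᵥ b) := by
      intro a b
      rw [star_smul, smul_dotProduct, dotProduct_smul, smul_eq_mul, smul_eq_mul, ← mul_assoc,
        star_inv₀, Complex.star_def, Complex.conj_ofReal, hsN]
    simp only [this]
    rw [← mul_sum, key]
    split_ifs
    · have : (N : ℂ) ≠ 0 := by exact_mod_cast hN.ne'
      rw [inv_mul_cancel₀ this]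
    · simp

end Completion

section TruncatedNorm

/-- The sum of the absolute values of the first `n` coefficients. -/
def coeffSum (n : ℕ) (p : ℂ[X]) : ℝ := ∑ i ∈ range n, ‖p.coeff i‖

lemma coeffSum_nonneg (n : ℕ) (p : ℂ[X]) : 0 ≤ coeffSum n p := sum_nonneg fun _ _ => norm_nonneg _

lemma coeffSum_C_mul (n : ℕ) (a : ℂ) (p : ℂ[X]) : coeffSum n (C a * p) = ‖a‖ * coeffSum n p := by
  simp [coeffSum, mul_sum]

lemma coeffSum_add_le (n : ℕ) (p q : ℂ[X]) : coeffSum n (p + q) ≤ coeffSum n p + coeffSum n q := by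
  rw [coeffSum, coeffSum, coeffSum, ← sum_add_distrib]
  exact sum_le_sum fun i _ => by rw [coeff_add]; exact norm_add_le _ _

lemma coeffSum_sum_le {ι : Type*} (n : ℕ) (s : Finset ι) (p : ι → ℂ[X]) :
    coeffSum n (∑ i ∈ s, p i) ≤ ∑ i ∈ s, coeffSum n (p i) := by
  simp only [coeffSum]
  rw [sum_comm]
  exact sum_le_sum fun i _ => by rw [finsetSum_coeff]; exact norm_sum_le _ _

lemma coeffSum_X_pow_le (n k : ℕ) : coeffSum n (X ^ k) ≤ 1 := by
  simp only [coeffSum, coeff_X_pow]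
  calc ∑ i ∈ range n, ‖(if i = k then 1 else 0 : ℂ)‖ = ∑ i ∈ range n, if i = k then 1 else 0 := by
        exact sum_congr rfl fun i _ => by split_ifs <;> simp
    _ ≤ 1 := by rw [sum_ite_eq' (range n) k (fun _ => (1 : ℝ))]; split_ifs <;> norm_num

lemma coeffSum_mul_le (n : ℕ) (p q : ℂ[X]) : coeffSum n (p * q) ≤ coeffSum n p * coeffSum n q := by
  have h1 : coeffSum n (p * q) ≤
      ∑ i ∈ range n, ∑ x ∈ antidiagonal i, ‖p.coeff x.1‖ * ‖q.coeff x.2‖ := by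
    refine sum_le_sum fun i _ => ?_
    rw [coeff_mul]
    refine (norm_sum_le _ _).trans_eq ?_
    simp only [norm_mul]
  have h2 : ∑ i ∈ range n, ∑ x ∈ antidiagonal i, ‖p.coeff x.1‖ * ‖q.coeff x.2‖ =
      ∑ x ∈ (range n ×ˢ range n).filter (fun x => x.1 + x.2 < n),
        ‖p.coeff x.1‖ * ‖q.coeff x.2‖ := by
    rw [← sum_fiberwise_of_maps_to (t := range n) (g := fun x : ℕ × ℕ => x.1 + x.2)]
    · refine sum_congr rfl fun i hi => sum_congr ?_ fun _ _ => rfl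
      ext ⟨a, b⟩
      simp only [mem_range] at hi
      simp only [HasAntidiagonal.mem_antidiagonal, mem_filter, mem_product, mem_range]
      omega
    · intro x hx
      simpa using (mem_filter.1 hx).2
  refine h1.trans (h2.trans_le ?_)
  rw [coeffSum, coeffSum, sum_mul_sum, ← sum_product']
  exact sum_le_sum_of_subset_of_nonneg (filter_subset _ _) fun _ _ _ => by positivity

end TruncatedNorm

section ExpPoly

/-- `(z ^ 2 + 1) / 2`, which is `z * cos θ` at `z = exp (i θ)`. -/
def shiftedCos : ℂ[X] := C (1 / 2) * (X ^ 2 + 1)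

/-- `z ^ K` times the `K`-th Taylor polynomial of `exp (s * x)` at `x = (z + z⁻¹) / 2`. -/
def expPoly (s : ℂ) (K : ℕ) : ℂ[X] :=
  ∑ k ∈ range (K + 1), C (s ^ k / (k.factorial : ℂ)) * (X ^ (K - k) * shiftedCos ^ k)

lemma natDegree_shiftedCos_pow_le (k : ℕ) : (shiftedCos ^ k).natDegree ≤ 2 * k := by
  refine natDegree_pow_le.trans ?_
  have : shiftedCos.natDegree ≤ 2 := by
    rw [shiftedCos]; compute_degree
  nlinarith

lemma reflect_shiftedCos_pow (k : ℕ) : (shiftedCos ^ k).reflect (2 * k) = shiftedCos ^ k := by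
  induction k with
  | zero => simp
  | succ k ih =>
    have h1 : shiftedCos.reflect 2 = shiftedCos := by
      rw [shiftedCos, reflect_C_mul, reflect_add, reflect_monomial, reflect_one, revAt_le le_rfl]
      simp [add_comm]
    have h2 : shiftedCos.natDegree ≤ 2 := by simpa using natDegree_shiftedCos_pow_le 1
    rw [pow_succ, show 2 * (k + 1) = 2 * k + 2 by ring,
      reflect_mul _ _ (natDegree_shiftedCos_pow_le k) h2, ih, h1]

/-- On the circle, the conjugate of `expPoly s K`, multiplied by `z ^ (2 * K)`, is
`expPoly (star s) K`, because `cos θ` is real. -/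
lemma reflect_expPoly_map (s : ℂ) (K : ℕ) :
    ((expPoly s K).map (starRingEnd ℂ)).reflect (2 * K) = expPoly (star s) K := by
  have hsum : ∀ (t : Finset ℕ) (f : ℕ → ℂ[X]),
      (∑ k ∈ t, f k).reflect (2 * K) = ∑ k ∈ t, (f k).reflect (2 * K) := by
    intro t f
    induction t using Finset.induction_on with
    | empty => simp
    | insert a t ha ih => rw [sum_insert ha, sum_insert ha, reflect_add, ih]
  rw [expPoly, expPoly, Polynomial.map_sum, hsum]
  refine sum_congr rfl fun k hk => ?_
  have hkK : k ≤ K := Nat.lt_succ_iff.1 (mem_range.1 hk)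
  have hmap : shiftedCos.map (starRingEnd ℂ) = shiftedCos := by
    simp [shiftedCos, map_ofNat (starRingEnd ℂ) 2]
  rw [Polynomial.map_mul, Polynomial.map_mul, Polynomial.map_pow, Polynomial.map_pow, hmap, map_X,
    map_C, reflect_C_mul, show 2 * K = 2 * (K - k) + 2 * k by omega,
    reflect_mul _ _ ((natDegree_X_pow_le _).trans (by omega)) (natDegree_shiftedCos_pow_le k),
    reflect_shiftedCos_pow, reflect_monomial, revAt_le (by omega),
    show 2 * (K - k) - (K - k) = K - k by omega]
  simp

lemma natDegree_expPoly_le (s : ℂ) (K : ℕ) : (expPoly s K).natDegree ≤ 2 * K := by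
  refine natDegree_sum_le_of_forall_le _ _ fun k hk => ?_
  have hkK : k ≤ K := Nat.lt_succ_iff.1 (mem_range.1 hk)
  refine (natDegree_C_mul_le _ _).trans (natDegree_mul_le.trans ?_)
  have := natDegree_shiftedCos_pow_le k
  have h2 := natDegree_X_pow_le (R := ℂ) (K - k)
  omega

lemma autocorr_expPoly (s : ℂ) (K l : ℕ) :
    autocorr (2 * K) (expPoly s K).coeff l =
      (expPoly (star s) K * expPoly s K).coeff (2 * K + l) := by
  rw [coeff_mul, Nat.sum_antidiagonal_eq_sum_range_succ
    (fun a b => (expPoly (star s) K).coeff a * (expPoly s K).coeff b),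
    ← sum_subset (s₁ := range (2 * K + 1)), autocorr, ← sum_range_reflect]
  · refine sum_congr rfl fun k hk => ?_
    have hk' : k ≤ 2 * K := Nat.lt_succ_iff.1 (mem_range.1 hk)
    rw [← reflect_expPoly_map, coeff_reflect, revAt_le hk', coeff_map,
      show 2 * K + 1 - 1 - k + l = 2 * K + l - k by omega,
      show 2 * K + 1 - 1 - k = 2 * K - k by omega]
    rfl
  · intro k hk
    simp only [mem_range] at hk ⊢; omega
  · intro k _ hk
    have : 2 * K < k := by simp only [mem_range] at hk; omega
    rw [coeff_eq_zero_of_natDegree_lt ((natDegree_expPoly_le _ K).trans_lt this), zero_mul]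

lemma sum_antidiagonal_exp_coeff (x y : ℂ) (m : ℕ) :
    ∑ p ∈ antidiagonal m, x ^ p.1 / (p.1.factorial : ℂ) * (y ^ p.2 / (p.2.factorial : ℂ)) =
      (x + y) ^ m / (m.factorial : ℂ) := by
  rw [(Commute.all x y).add_pow', sum_div]
  refine sum_congr rfl fun p hp => ?_
  rw [HasAntidiagonal.mem_antidiagonal] at hp
  subst hp
  have h := Nat.add_choose_mul_factorial_mul_factorial p.1 p.2
  rw [← Nat.choose_symm_add] at h
  have h' : (((p.1 + p.2).choose p.1 : ℕ) : ℂ) * (p.1.factorial : ℂ) * (p.2.factorial : ℂ) =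
      ((p.1 + p.2).factorial : ℂ) := by exact_mod_cast h
  have h1 : (p.1.factorial : ℂ) ≠ 0 := by exact_mod_cast p.1.factorial_ne_zero
  have h2 : (p.2.factorial : ℂ) ≠ 0 := by exact_mod_cast p.2.factorial_ne_zero
  have h3 : ((p.1 + p.2).factorial : ℂ) ≠ 0 := by exact_mod_cast (p.1 + p.2).factorial_ne_zero
  rw [nsmul_eq_mul]
  field_simp
  rw [← h']; ring

/-- In the product of the Taylor polynomials of `exp (-s * x)` and `exp (s * x)` all terms of positive
degree at most `K` cancel. -/
theorem expPoly_mul_expPoly_neg (s : ℂ) (K : ℕ) :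
    expPoly (-s) K * expPoly s K = X ^ (2 * K) +
      ∑ p ∈ (range (K + 1) ×ˢ range (K + 1)).filter (fun p => K < p.1 + p.2),
        C ((-s) ^ p.1 / (p.1.factorial : ℂ) * (s ^ p.2 / (p.2.factorial : ℂ))) *
          (X ^ (2 * K - (p.1 + p.2)) * shiftedCos ^ (p.1 + p.2)) := by
  rw [expPoly, expPoly, sum_mul_sum, ← sum_product',
    ← sum_filter_not_add_sum_filter _ (fun p : ℕ × ℕ => K < p.1 + p.2)]
  have hterm : ∀ p ∈ range (K + 1) ×ˢ range (K + 1),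
      C ((-s) ^ p.1 / (p.1.factorial : ℂ)) * (X ^ (K - p.1) * shiftedCos ^ p.1) *
        (C (s ^ p.2 / (p.2.factorial : ℂ)) * (X ^ (K - p.2) * shiftedCos ^ p.2)) =
      C ((-s) ^ p.1 / (p.1.factorial : ℂ) * (s ^ p.2 / (p.2.factorial : ℂ))) *
          (X ^ (2 * K - (p.1 + p.2)) * shiftedCos ^ (p.1 + p.2)) := by
    intro p hp
    simp only [mem_product, mem_range] at hp
    rw [show 2 * K - (p.1 + p.2) = (K - p.1) + (K - p.2) by omega, C_mul, pow_add, pow_add]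
    ring
  congr 1
  · rw [sum_congr rfl fun p hp => hterm p (mem_filter.1 hp).1,
      ← sum_fiberwise_of_maps_to (t := range (K + 1)) (g := fun x : ℕ × ℕ => x.1 + x.2)]
    · have hfib : ∀ m ∈ range (K + 1), ∑ p ∈ ((range (K + 1) ×ˢ range (K + 1)).filter
            (fun p => ¬ K < p.1 + p.2)).filter (fun p => p.1 + p.2 = m),
          C ((-s) ^ p.1 / (p.1.factorial : ℂ) * (s ^ p.2 / (p.2.factorial : ℂ))) *
            (X ^ (2 * K - (p.1 + p.2)) * shiftedCos ^ (p.1 + p.2)) =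
          C ((-s + s) ^ m / (m.factorial : ℂ)) * (X ^ (2 * K - m) * shiftedCos ^ m) := by
        intro m hm
        rw [mem_range] at hm
        have : ((range (K + 1) ×ˢ range (K + 1)).filter
            (fun p => ¬ K < p.1 + p.2)).filter (fun p => p.1 + p.2 = m) = antidiagonal m := by
          ext ⟨a, b⟩
          simp only [HasAntidiagonal.mem_antidiagonal, mem_filter, mem_product, mem_range]
          omega
        rw [this, ← sum_antidiagonal_exp_coeff, map_sum, sum_mul]
        refine sum_congr rfl fun p hp => ?_
        rw [HasAntidiagonal.mem_antidiagonal] at hp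
        rw [hp]
      rw [sum_congr rfl hfib, sum_eq_single 0]
      · simp
      · intro m _ hm
        simp [hm]
      · simp
    · intro p hp
      have := (mem_filter.1 hp).2
      simp only [mem_range]; omega
  · exact sum_congr rfl fun p hp => hterm p (mem_filter.1 hp).1

lemma coeffSum_shiftedCos_pow_le {n : ℕ} (k : ℕ) : coeffSum n (shiftedCos ^ k) ≤ 1 := by
  induction k with
  | zero => simpa using coeffSum_X_pow_le n 0
  | succ k ih =>
    have h1 : coeffSum n shiftedCos ≤ 1 := by
      rw [shiftedCos, coeffSum_C_mul]
      have := coeffSum_add_le n (X ^ 2) 1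
      have h2 := coeffSum_X_pow_le n 2
      have h3 := coeffSum_X_pow_le n 0
      rw [pow_zero] at h3
      norm_num
      linarith
    rw [pow_succ]
    exact (coeffSum_mul_le _ _ _).trans
      (mul_le_one₀ ih (coeffSum_nonneg _ _) h1)

/-- The remaining terms have degree more than `K`; each is bounded by inserting the factor
`exp (p.1 + p.2 - K) ≥ 1`. -/
theorem coeffSum_expPoly_mul_sub_le (n : ℕ) (s : ℂ) (K : ℕ) :
    coeffSum n (expPoly (-s) K * expPoly s K - X ^ (2 * K)) ≤
      Real.exp (2 * (Real.exp 1 * ‖s‖) - K) := by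
  rw [expPoly_mul_expPoly_neg, add_sub_cancel_left]
  refine (coeffSum_sum_le _ _ _).trans ?_
  set x := Real.exp 1 * ‖s‖ with hx
  have hx0 : 0 ≤ x := by positivity
  have hterm : ∀ p ∈ (range (K + 1) ×ˢ range (K + 1)).filter (fun p => K < p.1 + p.2),
      coeffSum n (C ((-s) ^ p.1 / (p.1.factorial : ℂ) * (s ^ p.2 / (p.2.factorial : ℂ))) *
          (X ^ (2 * K - (p.1 + p.2)) * shiftedCos ^ (p.1 + p.2))) ≤
        Real.exp (-K) * (x ^ p.1 / p.1.factorial * (x ^ p.2 / p.2.factorial)) := by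
    intro p hp
    have hK := (mem_filter.1 hp).2
    rw [coeffSum_C_mul]
    have h1 : coeffSum n (X ^ (2 * K - (p.1 + p.2)) * shiftedCos ^ (p.1 + p.2)) ≤ 1 :=
      (coeffSum_mul_le _ _ _).trans
        (mul_le_one₀ (coeffSum_X_pow_le _ _) (coeffSum_nonneg _ _) (coeffSum_shiftedCos_pow_le _))
    have h2 : ‖(-s) ^ p.1 / (p.1.factorial : ℂ) * (s ^ p.2 / (p.2.factorial : ℂ))‖ =
        ‖s‖ ^ p.1 / p.1.factorial * (‖s‖ ^ p.2 / p.2.factorial) := by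
      simp
    rw [h2]
    have h3 : 1 ≤ Real.exp (-K) * (Real.exp 1 ^ p.1 * Real.exp 1 ^ p.2) := by
      rw [← pow_add, ← Real.exp_nat_mul, ← Real.exp_add]
      apply Real.one_le_exp
      have : (K : ℝ) ≤ ((p.1 + p.2 : ℕ) : ℝ) := by exact_mod_cast hK.le
      linarith
    calc _ ≤ ‖s‖ ^ p.1 / p.1.factorial * (‖s‖ ^ p.2 / p.2.factorial) * 1 := by gcongr
      _ ≤ ‖s‖ ^ p.1 / p.1.factorial * (‖s‖ ^ p.2 / p.2.factorial) *
          (Real.exp (-K) * (Real.exp 1 ^ p.1 * Real.exp 1 ^ p.2)) := by gcongr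
      _ = _ := by rw [hx, mul_pow, mul_pow]; ring
  calc _ ≤ _ := sum_le_sum hterm
    _ ≤ ∑ p ∈ range (K + 1) ×ˢ range (K + 1),
        Real.exp (-K) * (x ^ p.1 / p.1.factorial * (x ^ p.2 / p.2.factorial)) :=
      sum_le_sum_of_subset_of_nonneg (filter_subset _ _) fun _ _ _ => by positivity
    _ = Real.exp (-K) * ((∑ a ∈ range (K + 1), x ^ a / a.factorial) *
        ∑ b ∈ range (K + 1), x ^ b / b.factorial) := by
      rw [← mul_sum, sum_mul_sum, ← sum_product']
    _ ≤ Real.exp (-K) * (Real.exp x * Real.exp x) := by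
      gcongr <;> exact Real.sum_le_exp_of_nonneg hx0 _
    _ = _ := by rw [← Real.exp_add, ← Real.exp_add]; congr 1; ring

/-- For imaginary `s` the function `exp (s * cos θ)` has modulus one, so the completion of its truncation
hardly changes the normalization. -/
theorem abs_completionBound_sub_one_le {s : ℂ} (hs : star s = -s) (K : ℕ) :
    |completionBound (2 * K) (expPoly s K).coeff - 1| ≤
      2 * Real.exp (2 * (Real.exp 1 * ‖s‖) - K) := by
  set c := (expPoly s K).coeff
  set r := expPoly (-s) K * expPoly s K - X ^ (2 * K) with hr
  have hρ : ∀ l, autocorr (2 * K) c l - (if l = 0 then 1 else 0) = r.coeff (2 * K + l) := by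
    intro l
    rw [autocorr_expPoly, hs, hr, coeff_sub, coeff_X_pow]
    simp
  have h0 : ((∑ k ∈ range (2 * K + 1), ‖c k‖ ^ 2 : ℝ) : ℂ) = autocorr (2 * K) c 0 := by
    rw [autocorr]
    push_cast
    exact sum_congr rfl fun k _ => by rw [← Complex.conj_mul']; rfl
  have h1 : |∑ k ∈ range (2 * K + 1), ‖c k‖ ^ 2 - 1| = ‖r.coeff (2 * K)‖ := by
    rw [← Real.norm_eq_abs, ← Complex.norm_real]
    push_cast at h0 ⊢
    rw [h0]
    have := hρ 0
    simp only [if_true, add_zero] at this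
    rw [this]
  have h2 : ∀ l, ‖autocorr (2 * K) c (l + 1)‖ = ‖r.coeff (2 * K + (l + 1))‖ := by
    intro l
    rw [← hρ (l + 1)]; simp
  have h3 : ‖r.coeff (2 * K)‖ + ∑ l ∈ range (2 * K), ‖r.coeff (2 * K + (l + 1))‖ ≤
      coeffSum (2 * K + (2 * K + 1)) r := by
    rw [coeffSum, sum_range_add, sum_range_succ' _ (2 * K), add_zero]
    have : 0 ≤ ∑ x ∈ range (2 * K), ‖r.coeff x‖ := sum_nonneg fun _ _ => norm_nonneg _
    linarith
  have h4 := coeffSum_expPoly_mul_sub_le (2 * K + (2 * K + 1)) s K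
  rw [completionBound]
  simp only [h2]
  have h5 : 0 ≤ ∑ l ∈ range (2 * K), ‖r.coeff (2 * K + (l + 1))‖ :=
    sum_nonneg fun _ _ => norm_nonneg _
  have h6 := abs_le.1 h1.le
  have h7 := norm_nonneg (r.coeff (2 * K))
  rw [abs_le]
  constructor <;> linarith

/-- The tail of the exponential series, bounded by inserting the factor `exp (k - K) ≥ 1`. -/
theorem norm_exp_sub_sum_le {𝔸 : Type*} [NormedRing 𝔸] [NormedAlgebra ℂ 𝔸] [CompleteSpace 𝔸]
    [NormOneClass 𝔸] (a : 𝔸) (K : ℕ) :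
    ‖NormedSpace.exp a - ∑ k ∈ range (K + 1), (k.factorial : ℂ)⁻¹ • a ^ k‖ ≤
      Real.exp (Real.exp 1 * ‖a‖ - K) := by
  have hs := NormedSpace.expSeries_summable' (𝕂 := ℂ) a
  have hn := NormedSpace.norm_expSeries_summable' (𝕂 := ℂ) a
  rw [NormedSpace.exp_eq_tsum ℂ]
  simp only
  rw [← hs.sum_add_tsum_nat_add (K + 1), add_sub_cancel_left]
  set x := Real.exp 1 * ‖a‖ with hx
  have hx0 : 0 ≤ x := by positivity
  have hE : HasSum (fun k : ℕ => x ^ k / k.factorial) (Real.exp x) := by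
    rw [Real.exp_eq_exp_ℝ]; exact NormedSpace.expSeries_div_hasSum_exp x
  have hn' := (summable_nat_add_iff (K + 1)).2 hn
  have hE' := (summable_nat_add_iff (K + 1)).2 hE.summable
  have hle : ∀ k : ℕ, ‖((k + (K + 1)).factorial : ℂ)⁻¹ • a ^ (k + (K + 1))‖ ≤
      Real.exp (-K) * (x ^ (k + (K + 1)) / (k + (K + 1)).factorial) := by
    intro k
    generalize hm : k + (K + 1) = m
    have h3 : 1 ≤ Real.exp (-K) * Real.exp 1 ^ m := by
      rw [← Real.exp_nat_mul, ← Real.exp_add]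
      apply Real.one_le_exp
      have : (K : ℝ) ≤ (m : ℝ) := by exact_mod_cast (by omega : K ≤ m)
      linarith
    calc _ ≤ (m.factorial : ℝ)⁻¹ * ‖a‖ ^ m := by
          rw [norm_smul, norm_inv, Complex.norm_natCast]
          gcongr
          exact norm_pow_le a m
      _ ≤ (m.factorial : ℝ)⁻¹ * ‖a‖ ^ m * (Real.exp (-K) * Real.exp 1 ^ m) :=
          le_mul_of_one_le_right (by positivity) h3
      _ = _ := by rw [hx, mul_pow]; ring
  calc _ ≤ _ := norm_tsum_le_tsum_norm hn'
    _ ≤ ∑' k : ℕ, Real.exp (-K) * (x ^ (k + (K + 1)) / (k + (K + 1)).factorial) :=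
        hn'.tsum_le_tsum hle (hE'.mul_left _)
    _ = Real.exp (-K) * ∑' k : ℕ, x ^ (k + (K + 1)) / (k + (K + 1)).factorial := tsum_mul_left
    _ ≤ Real.exp (-K) * Real.exp x := by
        gcongr
        rw [← hE.tsum_eq, ← hE.summable.sum_add_tsum_nat_add (K + 1)]
        exact le_add_of_nonneg_left (sum_nonneg fun _ _ => by positivity)
    _ = _ := by rw [← Real.exp_add]; congr 1; ring

end ExpPoly

end

/-! ### Qubitization and circuits -/

section

-- Decidable equality of the basis of the whole space needs a larger instance search.
set_option synthInstance.maxSize 1024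

section Qubitization

lemma reflection_conjTranspose {F S : Type} [DecidableEq F] [Fintype S] (Z : Matrix F S ℂ) :
    ((2 : ℂ) • (Z * Zᴴ) - 1)ᴴ = (2 : ℂ) • (Z * Zᴴ) - 1 := by
  rw [Matrix.conjTranspose_sub, Matrix.conjTranspose_smul, Matrix.conjTranspose_mul]
  simp

variable {F S : Type} [Fintype F] [DecidableEq F] [Fintype S] [DecidableEq S]

/-- The hypothesis says that `(W + W⁻¹) / 2` acts on the range of `T` as `h`. Hence a polynomial in
`W + W⁻¹` acts there as the same polynomial in `h`. -/
lemma aeval_expPoly_mul {W : Matrix F F ℂ} {T : Matrix F S ℂ} {h : Matrix S S ℂ}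
    (hT : (W ^ 2 + 1) * T = (2 : ℂ) • (W * T * h)) (s : ℂ) (K : ℕ) :
    Polynomial.aeval W (expPoly s K) * T =
      W ^ K * T * ∑ k ∈ Finset.range (K + 1), (k.factorial : ℂ)⁻¹ • (s • h) ^ k := by
  have hcos : Polynomial.aeval W shiftedCos * T = W * T * h := by
    have : Polynomial.aeval W shiftedCos = (1 / 2 : ℂ) • (W ^ 2 + 1) := by
      rw [shiftedCos, ← Polynomial.smul_eq_C_mul]
      simp
    rw [this, Matrix.smul_mul, hT, smul_smul]
    norm_num
  have hcomm : Commute (Polynomial.aeval W shiftedCos) W := by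
    have := Polynomial.aeval_X (R := ℂ) W
    conv_rhs => rw [← this]
    exact (Commute.all shiftedCos Polynomial.X).map (Polynomial.aeval W)
  have hpow : ∀ k, Polynomial.aeval W shiftedCos ^ k * T = W ^ k * T * h ^ k := by
    intro k
    induction k with
    | zero => simp
    | succ k ih =>
      calc Polynomial.aeval W shiftedCos ^ (k + 1) * T
          = Polynomial.aeval W shiftedCos * (Polynomial.aeval W shiftedCos ^ k * T) := by
            rw [pow_succ', Matrix.mul_assoc]
        _ = (Polynomial.aeval W shiftedCos * W ^ k) * T * h ^ k := by
            rw [ih]; simp only [Matrix.mul_assoc]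
        _ = W ^ k * (Polynomial.aeval W shiftedCos * T) * h ^ k := by
            rw [(hcomm.pow_right k).eq]; simp only [Matrix.mul_assoc]
        _ = (W ^ k * W) * T * (h * h ^ k) := by rw [hcos]; simp only [Matrix.mul_assoc]
        _ = _ := by rw [← pow_succ, ← pow_succ']
  rw [expPoly, map_sum, Matrix.sum_mul, Matrix.mul_sum]
  refine Finset.sum_congr rfl fun k hk => ?_
  have hkK : k ≤ K := Nat.lt_succ_iff.1 (Finset.mem_range.1 hk)
  rw [← Polynomial.smul_eq_C_mul, map_smul, map_mul, map_pow, map_pow, Polynomial.aeval_X,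
    Matrix.smul_mul, Matrix.mul_assoc, hpow, ← Matrix.mul_assoc, ← Matrix.mul_assoc, ← pow_add,
    Nat.sub_add_cancel hkK, smul_pow, smul_smul, Matrix.mul_smul]
  congr 1
  field_simp

/-- The walk operator `G V R V'`: for `V' = V⁻¹` and `R = 2 Z Z† - 1` it is the product of `G` with the
reflection about the range of `V * Z`. -/
def walk (G V R V' : Matrix F F ℂ) : Matrix F F ℂ := G * V * R * V'

/-- Qubitization: on the range of `V * Z`, half the sum of the walk operator and its inverse acts as the
matrix that `G` block-encodes. -/
lemma walk_sq_add_one_mul {G V : Matrix F F ℂ} {Z : Matrix F S ℂ} (hG : G * G = 1)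
    (hV : Vᴴ * V = 1) (hZ : Zᴴ * Z = 1) {h : Matrix S S ℂ} (hh : (V * Z)ᴴ * G * (V * Z) = h) :
    ((walk G V ((2 : ℂ) • (Z * Zᴴ) - 1) Vᴴ) ^ 2 + 1) * (V * Z) =
      (2 : ℂ) • (walk G V ((2 : ℂ) • (Z * Zᴴ) - 1) Vᴴ * (V * Z) * h) := by
  set T := V * Z with hTdef
  have hTT : Tᴴ * T = 1 := by
    rw [hTdef, Matrix.conjTranspose_mul]
    calc Zᴴ * Vᴴ * (V * Z) = Zᴴ * (Vᴴ * V) * Z := by simp only [Matrix.mul_assoc]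
      _ = 1 := by rw [hV, Matrix.mul_one, hZ]
  have hVV : V * Vᴴ = 1 := mul_eq_one_comm.1 hV
  have hW : walk G V ((2 : ℂ) • (Z * Zᴴ) - 1) Vᴴ = G * ((2 : ℂ) • (T * Tᴴ) - 1) := by
    rw [walk, hTdef, Matrix.conjTranspose_mul, Matrix.mul_assoc G, Matrix.mul_assoc G,
      Matrix.mul_sub, Matrix.sub_mul, Matrix.mul_smul, Matrix.smul_mul, Matrix.mul_one, hVV]
    simp only [Matrix.mul_assoc]
  have h1 : walk G V ((2 : ℂ) • (Z * Zᴴ) - 1) Vᴴ * T = G * T := by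
    rw [hW, Matrix.mul_assoc, Matrix.sub_mul, Matrix.smul_mul, Matrix.mul_assoc T, hTT,
      Matrix.mul_one, Matrix.one_mul, two_smul, add_sub_cancel_right]
  rw [Matrix.add_mul, Matrix.one_mul, sq, Matrix.mul_assoc, h1]
  rw [hW, Matrix.mul_assoc, Matrix.sub_mul, Matrix.smul_mul, Matrix.one_mul,
    show T * Tᴴ * (G * T) = T * (Tᴴ * G * T) by simp only [Matrix.mul_assoc], hh, Matrix.mul_sub,
    ← Matrix.mul_assoc G G, hG, Matrix.one_mul, sub_add_cancel, Matrix.mul_smul,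
    ← Matrix.mul_assoc]

lemma reflection_mul_self {Z : Matrix F S ℂ} (hZ : Zᴴ * Z = 1) :
    ((2 : ℂ) • (Z * Zᴴ) - 1) * ((2 : ℂ) • (Z * Zᴴ) - 1) = 1 := by
  have : Z * Zᴴ * (Z * Zᴴ) = Z * Zᴴ := by
    rw [Matrix.mul_assoc, ← Matrix.mul_assoc Zᴴ, hZ, Matrix.one_mul]
  rw [sub_mul, mul_sub, one_mul, mul_one, Matrix.smul_mul, Matrix.mul_smul, this, smul_smul,
    two_smul, show (2 * 2 : ℂ) = 2 + 2 by norm_num, add_smul, two_smul]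
  abel

end Qubitization

section Tensor

variable {n w : ℕ} {ι : Type}

/-- The basis of the system, the query registers and a four-dimensional coin. -/
abbrev Base (n w : ℕ) : Type := Fin (2 ^ n) × (QueryReg n w × Fin 4)

/-- The basis of the whole space: `Base` together with a register indexed by `ι`, which together
with the coin makes up the workspace. -/
abbrev Full (n w : ℕ) (ι : Type) : Type := Fin (2 ^ n) × (QueryReg n w × (Fin 4 × ι))

/-- The decomposition of the whole space as `Base` times the additional register. -/
def splitFull (n w : ℕ) (ι : Type) : Full n w ι ≃ Base n w × ι where
  toFun x := ((x.1, (x.2.1, x.2.2.1)), x.2.2.2)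
  invFun y := (y.1.1, (y.1.2.1, (y.1.2.2, y.2)))
  left_inv _ := rfl
  right_inv _ := rfl

/-- `X ⊗ m` as an operator on the whole space. -/
def tens (X : Matrix (Base n w) (Base n w) ℂ) (m : Matrix ι ι ℂ) :
    Matrix (Full n w ι) (Full n w ι) ℂ :=
  (X ⊗ₖ m).submatrix (splitFull n w ι) (splitFull n w ι)

lemma tens_mul [Fintype ι] (X Y : Matrix (Base n w) (Base n w) ℂ) (m k : Matrix ι ι ℂ) :
    tens X m * tens Y k = tens (X * Y) (m * k) := by
  rw [tens, tens, Matrix.submatrix_mul_equiv, ← Matrix.mul_kronecker_mul, tens]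

lemma tens_one_one [DecidableEq ι] : tens (1 : Matrix (Base n w) (Base n w) ℂ) (1 : Matrix ι ι ℂ) = 1 := by
  rw [tens, Matrix.one_kronecker_one, Matrix.submatrix_one_equiv]

lemma tens_add (X : Matrix (Base n w) (Base n w) ℂ) (m k : Matrix ι ι ℂ) :
    tens X (m + k) = tens X m + tens X k := by
  rw [tens, Matrix.kronecker_add]; rfl

lemma tens_zero (X : Matrix (Base n w) (Base n w) ℂ) : tens X (0 : Matrix ι ι ℂ) = 0 := by
  rw [tens, Matrix.kronecker_zero]; rfl

lemma tens_conjTranspose (X : Matrix (Base n w) (Base n w) ℂ) (m : Matrix ι ι ℂ) :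
    (tens X m)ᴴ = tens Xᴴ mᴴ := by
  rw [tens, Matrix.conjTranspose_submatrix, Matrix.conjTranspose_kronecker, tens]

/-- A query does not touch the register `ι`. -/
lemma onQuery_eq_tens [DecidableEq ι] (M : Matrix (QueryReg n w) (QueryReg n w) ℂ) :
    onQuery (W := Fin 4 × ι) M = tens (onQuery M) 1 := by
  ext ⟨s, q, c, m⟩ ⟨s', q', c', m'⟩
  simp only [onQuery, tens, splitFull, Matrix.submatrix_apply, Matrix.kroneckerMap_apply,
    Matrix.one_apply, Prod.mk.injEq, Equiv.coe_fn_mk]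
  by_cases hc : c = c' <;> by_cases hm : m = m' <;> simp [hc, hm]

/-- `X`, controlled on the range of the projection `P` of the additional register. -/
def controlled [DecidableEq ι] (X : Matrix (Base n w) (Base n w) ℂ) (P : Matrix ι ι ℂ) :
    Matrix (Full n w ι) (Full n w ι) ℂ :=
  tens X P + tens 1 (1 - P)

lemma controlled_one [DecidableEq ι] (P : Matrix ι ι ℂ) : controlled (1 : Matrix (Base n w) (Base n w) ℂ) P = 1 := by
  rw [controlled, ← tens_add]
  simp [tens_one_one]

variable [Fintype ι] [DecidableEq ι]

lemma tens_pow (X : Matrix (Base n w) (Base n w) ℂ) (k : ℕ) :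
    tens X (1 : Matrix ι ι ℂ) ^ k = tens (X ^ k) 1 := by
  induction k with
  | zero => simp [tens_one_one]
  | succ k ih => rw [pow_succ, ih, tens_mul, pow_succ, mul_one]

/-- `m ↦ 1 ⊗ m`. -/
def ancillaHom (n w : ℕ) (ι : Type) [Fintype ι] [DecidableEq ι] :
    Matrix ι ι ℂ →+* Matrix (Full n w ι) (Full n w ι) ℂ where
  toFun m := tens 1 m
  map_one' := tens_one_one
  map_mul' m k := by rw [tens_mul, mul_one]
  map_zero' := tens_zero 1
  map_add' m k := tens_add 1 m k

lemma controlled_mul (X Y : Matrix (Base n w) (Base n w) ℂ) {P : Matrix ι ι ℂ} (hP : P * P = P) :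
    controlled X P * controlled Y P = controlled (X * Y) P := by
  have h1 : P * (1 - P) = 0 := by rw [mul_sub, hP]; simp
  have h2 : (1 - P) * P = 0 := by rw [sub_mul, hP]; simp
  have h3 : (1 - P) * (1 - P) = 1 - P := by rw [mul_sub, h2]; simp
  rw [controlled, controlled, controlled, add_mul, mul_add, mul_add, tens_mul, tens_mul, tens_mul,
    tens_mul, hP, h1, h2, h3, tens_zero, tens_zero, mul_one, add_zero, zero_add]

lemma controlled_mem_unitary {X : Matrix (Base n w) (Base n w) ℂ}
    (hX : X ∈ Matrix.unitaryGroup (Base n w) ℂ) {P : Matrix ι ι ℂ} (hP : Pᴴ = P) (hPP : P * P = P) :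
    controlled X P ∈ Matrix.unitaryGroup (Full n w ι) ℂ := by
  rw [Matrix.mem_unitaryGroup_iff, Matrix.star_eq_conjTranspose]
  have : (controlled X P)ᴴ = controlled Xᴴ P := by
    rw [controlled, Matrix.conjTranspose_add, tens_conjTranspose, tens_conjTranspose,
      Matrix.conjTranspose_sub, hP, controlled]
    simp
  rw [this, controlled_mul _ _ hPP, ← Matrix.star_eq_conjTranspose,
    Matrix.mem_unitaryGroup_iff.1 hX, controlled_one]

lemma tens_mem_unitary {X : Matrix (Base n w) (Base n w) ℂ} {m : Matrix ι ι ℂ}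
    (hX : X ∈ Matrix.unitaryGroup (Base n w) ℂ) (hm : m ∈ Matrix.unitaryGroup ι ℂ) :
    tens X m ∈ Matrix.unitaryGroup (Full n w ι) ℂ := by
  rw [Matrix.mem_unitaryGroup_iff, Matrix.star_eq_conjTranspose, tens_conjTranspose, tens_mul,
    ← Matrix.star_eq_conjTranspose, ← Matrix.star_eq_conjTranspose,
    Matrix.mem_unitaryGroup_iff.1 hX, Matrix.mem_unitaryGroup_iff.1 hm, tens_one_one]

end Tensor

section Circuits

variable {n w : ℕ} {W : Type} [Fintype W] [DecidableEq W]

/-- The operator applied by a sequence of steps, the head of the list being applied first. -/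
def stepsOp (O : Oracles n w) (l : List (Step n w W)) :
    Matrix (Fin (2 ^ n) × (QueryReg n w × W)) (Fin (2 ^ n) × (QueryReg n w × W)) ℂ :=
  l.foldl (fun M s => s.op O * M) 1

lemma stepsOp_append (O : Oracles n w) (l₁ l₂ : List (Step n w W)) :
    stepsOp O (l₁ ++ l₂) = stepsOp O l₂ * stepsOp O l₁ := by
  have h : ∀ (l : List (Step n w W)) M,
      l.foldl (fun M s => s.op O * M) M = stepsOp O l * M := by
    intro l
    induction l with
    | nil => intro M; simp [stepsOp]
    | cons s l ih =>
      intro M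
      rw [stepsOp, List.foldl_cons, List.foldl_cons, ih, ih (s.op O * 1)]
      simp [Matrix.mul_assoc]
  rw [stepsOp, List.foldl_append, h]
  rfl

/-- With `q` queries one can apply the operator `M O`, which may depend on the oracles. -/
def Computes (q : ℕ) (M : Oracles n w →
    Matrix (Fin (2 ^ n) × (QueryReg n w × W)) (Fin (2 ^ n) × (QueryReg n w × W)) ℂ) : Prop :=
  ∃ l : List (Step n w W), (l.map Step.cost).sum = q ∧ ∀ O, stepsOp O l = M O

variable {q q' : ℕ} {M M' : Oracles n w →
    Matrix (Fin (2 ^ n) × (QueryReg n w × W)) (Fin (2 ^ n) × (QueryReg n w × W)) ℂ}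

lemma Computes.mul (h : Computes q M) (h' : Computes q' M') :
    Computes (q + q') fun O => M O * M' O := by
  obtain ⟨l, hl, hM⟩ := h
  obtain ⟨l', hl', hM'⟩ := h'
  refine ⟨l' ++ l, ?_, fun O => ?_⟩
  · simp [hl, hl', add_comm]
  · rw [stepsOp_append, hM, hM']

lemma computes_one : Computes (n := n) (w := w) (W := W) 0 fun _ => 1 := ⟨[], rfl, fun _ => rfl⟩

lemma Computes.pow (h : Computes q M) (k : ℕ) : Computes (k * q) fun O => M O ^ k := by
  induction k with
  | zero => simpa using computes_one
  | succ k ih => simpa [pow_succ, Nat.succ_mul] using ih.mul h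

lemma Computes.list_prod {ι : Type} {N : ι → Oracles n w →
    Matrix (Fin (2 ^ n) × (QueryReg n w × W)) (Fin (2 ^ n) × (QueryReg n w × W)) ℂ} :
    ∀ l : List ι, (∀ i ∈ l, Computes q (N i)) →
      Computes (l.length * q) fun O => (l.map fun i => N i O).prod
  | [], _ => by simpa using computes_one
  | i :: l, h => by
    have := (h i (by simp)).mul (Computes.list_prod l fun j hj => h j (by simp [hj]))
    simpa [Nat.succ_mul, add_comm] using this

lemma computes_gate {G : Matrix (Fin (2 ^ n) × (QueryReg n w × W))
    (Fin (2 ^ n) × (QueryReg n w × W)) ℂ} (hG : G ∈ Matrix.unitaryGroup _ ℂ) :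
    Computes (n := n) (w := w) (W := W) 0 fun _ => G :=
  ⟨[Step.gate ⟨G, hG⟩], rfl, fun _ => by simp [stepsOp, Step.op]⟩

lemma computes_queryH :
    Computes (n := n) (w := w) (W := W) 1 fun O => onQuery (O.OH : Matrix _ _ ℂ) :=
  ⟨[Step.queryH], rfl, fun _ => by simp [stepsOp, Step.op]⟩

lemma computes_queryF :
    Computes (n := n) (w := w) (W := W) 1 fun O => onQuery (onIndices (O.OF : Matrix _ _ ℂ)) :=
  ⟨[Step.queryF], rfl, fun _ => by simp [stepsOp, Step.op]⟩

lemma computes_queryFInv :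
    Computes (n := n) (w := w) (W := W) 1 fun O => onQuery (onIndices (O.OF : Matrix _ _ ℂ)ᴴ) :=
  ⟨[Step.queryFInv], rfl, fun _ => by simp [stepsOp, Step.op]⟩

end Circuits

section Simulation

variable {n w : ℕ} {ι : Type} [Fintype ι] [DecidableEq ι]

/-- Query the position oracle on the state prepared by `D`, then let `A` act on the coin, controlled
on the matrix entry, which is computed before and uncomputed after. -/
def prepare (D A : Matrix (Base n w) (Base n w) ℂ) (O : Oracles n w) :
    Matrix (Base n w) (Base n w) ℂ :=
  onQuery (O.OH : Matrix _ _ ℂ) * A * onQuery (O.OH : Matrix _ _ ℂ) *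
    onQuery (onIndices (O.OF : Matrix _ _ ℂ)) * D

/-- The inverse of `prepare`, for an entry oracle that is its own inverse. -/
def unprepare (D A : Matrix (Base n w) (Base n w) ℂ) (O : Oracles n w) :
    Matrix (Base n w) (Base n w) ℂ :=
  Dᴴ * onQuery (onIndices (O.OF : Matrix _ _ ℂ)ᴴ) * onQuery (O.OH : Matrix _ _ ℂ) * Aᴴ *
    onQuery (O.OH : Matrix _ _ ℂ)

variable {D A : Matrix (Base n w) (Base n w) ℂ}

lemma computes_prepare (hD : D ∈ Matrix.unitaryGroup _ ℂ) (hA : A ∈ Matrix.unitaryGroup _ ℂ) :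
    Computes (W := Fin 4 × ι) 3 fun O => tens (prepare D A O) (1 : Matrix ι ι ℂ) := by
  have := (((computes_queryH (n := n) (w := w) (W := Fin 4 × ι)).mul
    (computes_gate (tens_mem_unitary hA (one_mem _)))).mul computes_queryH).mul
    computes_queryF |>.mul (computes_gate (tens_mem_unitary hD (one_mem _)))
  simp only [onQuery_eq_tens, tens_mul, mul_one] at this
  exact this

lemma computes_unprepare (hD : D ∈ Matrix.unitaryGroup _ ℂ) (hA : A ∈ Matrix.unitaryGroup _ ℂ) :
    Computes (W := Fin 4 × ι) 3 fun O => tens (unprepare D A O) (1 : Matrix ι ι ℂ) := by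
  have := ((((computes_gate (n := n) (w := w) (W := Fin 4 × ι)
    (tens_mem_unitary (Unitary.star_mem hD) (one_mem _))).mul
    computes_queryFInv).mul computes_queryH).mul
    (computes_gate (tens_mem_unitary (Unitary.star_mem hA) (one_mem _)))).mul computes_queryH
  simp only [onQuery_eq_tens, tens_mul, mul_one] at this
  exact this

/-- The whole circuit: the register `ι` is prepared by `U`, the walk operator is applied controlled
on each of the projections `Ps`, and finally `K` steps of the walk and the preparation are undone. -/
def simulationOp (D A G R : Matrix (Base n w) (Base n w) ℂ) (Ps : List (Matrix ι ι ℂ))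
    (U : Matrix ι ι ℂ) (K : ℕ) (O : Oracles n w) : Matrix (Full n w ι) (Full n w ι) ℂ :=
  tens (unprepare D A O) 1 * tens (prepare D A O * R * unprepare D A O * G) 1 ^ K *
    (Ps.map fun P => controlled G P * tens (prepare D A O) 1 * controlled R P *
      tens (unprepare D A O) 1).prod * tens (prepare D A O) 1 * tens 1 U

variable {G R : Matrix (Base n w) (Base n w) ℂ}

lemma computes_simulationOp (hD : D ∈ Matrix.unitaryGroup _ ℂ) (hA : A ∈ Matrix.unitaryGroup _ ℂ)
    (hG : G ∈ Matrix.unitaryGroup _ ℂ) (hR : R ∈ Matrix.unitaryGroup _ ℂ)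
    {Ps : List (Matrix ι ι ℂ)} (hPs : ∀ P ∈ Ps, Pᴴ = P ∧ P * P = P) {U : Matrix ι ι ℂ}
    (hU : U ∈ Matrix.unitaryGroup ι ℂ) (K : ℕ) :
    Computes (W := Fin 4 × ι) (6 * (K + Ps.length) + 6)
      fun O => simulationOp D A G R Ps U K O := by
  have hV := computes_prepare (ι := ι) hD hA
  have hV' := computes_unprepare (ι := ι) hD hA
  have hW := ((hV.mul (computes_gate (tens_mem_unitary hR (one_mem _)))).mul hV').mul
    (computes_gate (tens_mem_unitary hG (one_mem _)))
  simp only [tens_mul, mul_one] at hW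
  have hc : ∀ P ∈ Ps, Computes (W := Fin 4 × ι) (0 + 3 + 0 + 3) fun O =>
      controlled G P * tens (prepare D A O) 1 * controlled R P * tens (unprepare D A O) 1 := by
    intro P hP
    obtain ⟨h1, h2⟩ := hPs P hP
    exact (((computes_gate (controlled_mem_unitary hG h1 h2)).mul hV).mul
      (computes_gate (controlled_mem_unitary hR h1 h2))).mul hV'
  have := (((hV'.mul (hW.pow K)).mul (Computes.list_prod Ps hc)).mul hV).mul
    (computes_gate (tens_mem_unitary (one_mem _) hU))
  convert this using 1
  · ring
  · rfl

/-- Only the gates `G` and `R` have to be controlled: where the control is off, the queries in `V` and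
`V'` cancel. -/
lemma controlled_walk {P : Matrix ι ι ℂ} (hPP : P * P = P) {V V' : Matrix (Base n w) (Base n w) ℂ}
    (hVV : V * V' = 1) :
    controlled G P * tens V 1 * controlled R P * tens V' 1 =
      ancillaHom n w ι P * tens (walk G V R V') 1 + (1 - ancillaHom n w ι P) := by
  have h1 : tens V (1 : Matrix ι ι ℂ) * controlled R P * tens V' 1 = controlled (V * R * V') P := by
    rw [controlled, controlled, mul_add, add_mul, tens_mul, tens_mul, tens_mul, tens_mul, mul_one,
      mul_one, one_mul, one_mul, mul_one, hVV]
  calc _ = controlled G P * (tens V (1 : Matrix ι ι ℂ) * controlled R P * tens V' 1) := by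
        simp only [mul_assoc]
    _ = controlled (walk G V R V') P := by
        rw [h1, controlled_mul _ _ hPP, walk]; simp only [mul_assoc]
    _ = _ := by
        rw [controlled, ← map_one (ancillaHom n w ι), ← map_sub]
        change _ = tens 1 P * _ + tens 1 (1 - P)
        rw [tens_mul, one_mul, mul_one]

end Simulation

section Extraction

variable {n w : ℕ} {ι : Type} [Fintype ι] [DecidableEq ι]

/-- The isometry that adjoins the query registers and the coin in their initial states. -/
def initial (n w : ℕ) : Matrix (Base n w) (Fin (2 ^ n)) ℂ :=
  Matrix.of fun x s => if x = (s, ((0, 0, fun _ => false), 0)) then 1 else 0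

lemma initial_conjTranspose_mul_self : (initial n w)ᴴ * initial n w = 1 := by
  ext i j
  simp [initial, Matrix.mul_apply, Matrix.one_apply, eq_comm]

lemma initial_conj_apply (X : Matrix (Base n w) (Base n w) ℂ) (i j : Fin (2 ^ n)) :
    ((initial n w)ᴴ * X * initial n w) i j =
      X (i, ((0, 0, fun _ => false), 0)) (j, ((0, 0, fun _ => false), 0)) := by
  simp [initial, Matrix.mul_apply]

/-- Projecting the register `ι` onto its initial state first does not affect the amplitude of
returning from the initial state to itself. -/
lemma krausOp_mul_ancillaHom (C : Matrix (Full n w ι) (Full n w ι) ℂ) (i₀ : ι) (a : QueryReg n w)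
    (b : Fin 4) : krausOp (C * ancillaHom n w ι
        (Matrix.vecMulVec (Pi.single i₀ 1) (Pi.single i₀ 1))) (a, (b, i₀)) (a, (b, i₀)) =
      krausOp C (a, (b, i₀)) (a, (b, i₀)) := by
  ext i j
  rw [krausOp, krausOp, Matrix.submatrix_apply, Matrix.submatrix_apply, Matrix.mul_apply,
    Finset.sum_eq_single (j, (a, (b, i₀)))]
  · change _ * tens 1 _ _ _ = _
    simp [tens, splitFull, Matrix.vecMulVec_apply]
  · rintro ⟨s, q, c, m⟩ _ hne
    change _ * tens 1 _ _ _ = _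
    by_cases hm : m = i₀
    · subst hm
      have : ¬ (((s, (q, c)) : Base n w) = (j, (a, b))) := by
        rintro h
        simp only [Prod.mk.injEq] at h
        exact hne (by simp [h])
      simp [tens, splitFull, this, -Prod.mk.injEq]
    · simp [tens, splitFull, Matrix.vecMulVec_apply, hm]
  · simp

/-- The block of the whole circuit at the initial state of the ancillas is a multiple of the Taylor
polynomial of `exp (s • h)`. -/
theorem krausOp_simulationOp {D A G : Matrix (Base n w) (Base n w) ℂ} {O : Oracles n w}
    (hV : (prepare D A O)ᴴ * prepare D A O = 1) (hV' : unprepare D A O = (prepare D A O)ᴴ)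
    (hG : G * G = 1) {h : Matrix (Fin (2 ^ n)) (Fin (2 ^ n)) ℂ}
    (hh : (prepare D A O * initial n w)ᴴ * G * (prepare D A O * initial n w) = h)
    {Ps : List (Matrix ι ι ℂ)} (hPs : ∀ P ∈ Ps, Pᴴ = P ∧ P * P = P) (i₀ : ι) {u : ι → ℂ}
    {U : Matrix ι ι ℂ} (hU : ∀ i, U i i₀ = u i) {K : ℕ} {v : ℕ → ι → ℂ} {c s : ℂ}
    (hv : ∀ k, v k i₀ = c * (expPoly s K).coeff k)
    (hfac : ∀ {R : Type} [Ring R] (π : Matrix ι ι ℂ →+* R) (W : R), (∀ m, Commute (π m) W) →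
      (Ps.map fun P => π P * W + (1 - π P)).prod * π (Matrix.vecMulVec u (Pi.single i₀ 1)) =
        ∑ k ∈ Finset.range (2 * K + 1), W ^ k * π (Matrix.vecMulVec (v k) (Pi.single i₀ 1))) :
    krausOp (simulationOp D A G ((2 : ℂ) • (initial n w * (initial n w)ᴴ) - 1) Ps U K O)
        ((0, 0, fun _ => false), (0, i₀)) ((0, 0, fun _ => false), (0, i₀)) =
      c • ∑ k ∈ Finset.range (K + 1), (k.factorial : ℂ)⁻¹ • (s • h) ^ k := by
  set V := prepare D A O with hVdef
  set Z := initial n w with hZdef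
  set R := (2 : ℂ) • (Z * Zᴴ) - 1 with hR
  have hZZ : Zᴴ * Z = 1 := initial_conjTranspose_mul_self
  have hVV : V * Vᴴ = 1 := mul_eq_one_comm.1 hV
  set W := walk G V R Vᴴ with hW
  have hRR : R * R = 1 := reflection_mul_self hZZ
  have hinv : V * R * Vᴴ * G * W = 1 := by
    rw [hW, walk]
    calc V * R * Vᴴ * G * (G * V * R * Vᴴ) = V * R * Vᴴ * (G * G) * V * R * Vᴴ := by
          simp only [Matrix.mul_assoc]
      _ = V * (R * ((Vᴴ * V) * R)) * Vᴴ := by rw [hG]; simp only [Matrix.mul_assoc, Matrix.one_mul]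
      _ = 1 := by rw [hV, Matrix.one_mul, hRR, Matrix.mul_one, hVV]
  have hinvK : (V * R * Vᴴ * G) ^ K * W ^ K = 1 := by
    have hc : Commute (V * R * Vᴴ * G) W := by
      rw [commute_iff_eq, hinv, mul_eq_one_comm.1 hinv]
    rw [← hc.mul_pow, hinv, one_pow]
  set C := simulationOp D A G R Ps U K O with hC
  have hCE : C * ancillaHom n w ι (Matrix.vecMulVec (Pi.single i₀ 1) (Pi.single i₀ 1)) =
      ∑ k ∈ Finset.range (2 * K + 1), tens (Vᴴ * (V * R * Vᴴ * G) ^ K * W ^ k * V)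
        (Matrix.vecMulVec (v k) (Pi.single i₀ 1)) := by
    have hprod : (Ps.map fun P => controlled G P * tens V 1 * controlled R P * tens Vᴴ 1) =
        Ps.map fun P => ancillaHom n w ι P * tens W 1 + (1 - ancillaHom n w ι P) :=
      List.map_congr_left fun P hP => controlled_walk (hPs P hP).2 hVV
    have hcomm : ∀ m : Matrix ι ι ℂ, Commute (ancillaHom n w ι m) (tens W 1) := by
      intro m
      change tens 1 m * tens W 1 = tens W 1 * tens 1 m
      rw [tens_mul, tens_mul]; simp
    have hUE : tens V (1 : Matrix ι ι ℂ) * tens 1 U * ancillaHom n w ι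
        (Matrix.vecMulVec (Pi.single i₀ 1) (Pi.single i₀ 1)) =
        ancillaHom n w ι (Matrix.vecMulVec u (Pi.single i₀ 1)) * tens V 1 := by
      change tens V 1 * tens 1 U * tens 1 _ = tens 1 _ * tens V 1
      rw [tens_mul, tens_mul, tens_mul]
      simp only [mul_one, one_mul, Matrix.mul_vecMulVec]
      congr 2
      ext i
      simp [hU]
    rw [hC, simulationOp, hV', ← hVdef, hprod]
    calc _ = tens Vᴴ 1 * tens (V * R * Vᴴ * G) 1 ^ K *
          (List.map (fun P => ancillaHom n w ι P * tens W 1 + (1 - ancillaHom n w ι P)) Ps).prod *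
          (tens V 1 * tens 1 U * ancillaHom n w ι
            (Matrix.vecMulVec (Pi.single i₀ 1) (Pi.single i₀ 1))) := by simp only [mul_assoc]
      _ = tens Vᴴ 1 * tens (V * R * Vᴴ * G) 1 ^ K *
          ((List.map (fun P => ancillaHom n w ι P * tens W 1 + (1 - ancillaHom n w ι P)) Ps).prod *
          ancillaHom n w ι (Matrix.vecMulVec u (Pi.single i₀ 1))) * tens V 1 := by
          rw [hUE]; simp only [mul_assoc]
      _ = _ := by
          rw [hfac _ _ hcomm, Finset.mul_sum, Finset.sum_mul]
          refine Finset.sum_congr rfl fun k _ => ?_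
          change _ * (_ * tens 1 _) * _ = _
          rw [tens_pow, tens_pow, tens_mul, tens_mul, tens_mul, tens_mul]
          simp only [mul_one, one_mul, mul_assoc]
  rw [← krausOp_mul_ancillaHom, hCE]
  have hpoly : Zᴴ * (Vᴴ * (V * R * Vᴴ * G) ^ K * Polynomial.aeval W (expPoly s K) * V) * Z =
      ∑ k ∈ Finset.range (K + 1), (k.factorial : ℂ)⁻¹ • (s • h) ^ k := by
    calc _ = Zᴴ * Vᴴ * (V * R * Vᴴ * G) ^ K * (Polynomial.aeval W (expPoly s K) * (V * Z)) := by
          simp only [Matrix.mul_assoc]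
      _ = Zᴴ * Vᴴ * ((V * R * Vᴴ * G) ^ K * W ^ K) * V * Z *
          ∑ k ∈ Finset.range (K + 1), (k.factorial : ℂ)⁻¹ • (s • h) ^ k := by
          rw [aeval_expPoly_mul (walk_sq_add_one_mul hG hV hZZ hh)]
          simp only [Matrix.mul_assoc]
          rfl
      _ = Zᴴ * (Vᴴ * V) * Z * ∑ k ∈ Finset.range (K + 1), (k.factorial : ℂ)⁻¹ • (s • h) ^ k := by
          rw [hinvK]; simp only [Matrix.mul_assoc, Matrix.one_mul]
      _ = _ := by rw [hV, Matrix.mul_one, hZZ, Matrix.one_mul]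
  rw [← hpoly]
  ext i j
  rw [Matrix.smul_apply, initial_conj_apply,
    Polynomial.aeval_eq_sum_range' (Nat.lt_succ_of_le (natDegree_expPoly_le s K)), Matrix.mul_sum,
    Matrix.sum_mul, Matrix.sum_apply, krausOp, Matrix.submatrix_apply, Matrix.sum_apply,
    smul_eq_mul, Finset.mul_sum]
  refine Finset.sum_congr rfl fun k _ => ?_
  rw [Matrix.mul_smul, Matrix.smul_mul, Matrix.smul_apply, tens, Matrix.submatrix_apply]
  change _ * (v k i₀ * (Pi.single i₀ 1 : ι → ℂ) i₀) = _
  rw [hv, Pi.single_eq_same, smul_eq_mul]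
  simp only [splitFull, Equiv.coe_fn_mk]
  ring

end Extraction

end

/-! ### Block encoding of a sparse matrix by the oracles -/

section

set_option synthInstance.maxSize 1024

section Kets

lemma mulVec_ket_apply {κ κ' : Type} [Fintype κ] [DecidableEq κ] (M : Matrix κ' κ ℂ)
    (x : κ) (y : κ') :
    (M *ᵥ ket x) y = M y x := by
  simp [ket]

lemma ket_apply {κ : Type} [DecidableEq κ] (x y : κ) : ket x y = if y = x then 1 else 0 := by
  rw [ket, Pi.single_apply]

variable {n w : ℕ} {W : Type} [Fintype W] [DecidableEq W]

lemma onQuery_mulVec_ket {M : Matrix (QueryReg n w) (QueryReg n w) ℂ} {q q' : QueryReg n w}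
    (hM : M *ᵥ ket q = ket q') (s : Fin (2 ^ n)) (c : W) :
    onQuery M *ᵥ ket (s, (q, c)) = ket (s, (q', c)) := by
  have hM' : ∀ y, M y q = if y = q' then 1 else 0 := by
    intro y; rw [← mulVec_ket_apply M, hM, ket_apply]
  ext ⟨s', r, c'⟩
  rw [mulVec_ket_apply, ket_apply]
  simp only [onQuery, Matrix.kroneckerMap_apply, Matrix.one_apply, hM', Prod.mk.injEq]
  by_cases h1 : s' = s <;> by_cases h2 : r = q' <;> by_cases h3 : c' = c <;> simp [h1, h2, h3]

lemma onIndices_mulVec_ket {M : Matrix (Fin (2 ^ n) × Fin (2 ^ n)) (Fin (2 ^ n) × Fin (2 ^ n)) ℂ}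
    {p p' : Fin (2 ^ n) × Fin (2 ^ n)} (hM : M *ᵥ ket p = ket p') (z : Fin w → Bool) :
    onIndices M *ᵥ ket (p.1, (p.2, z)) = ket (p'.1, (p'.2, z)) := by
  have hM' : ∀ y, M y p = if y = p' then 1 else 0 := by
    intro y; rw [← mulVec_ket_apply M, hM, ket_apply]
  ext ⟨j, k, z'⟩
  rw [mulVec_ket_apply, ket_apply]
  simp only [onIndices, Matrix.reindex_apply, Matrix.submatrix_apply, Equiv.prodAssoc_symm_apply,
    Matrix.kroneckerMap_apply, Matrix.one_apply, hM', Prod.ext_iff]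
  by_cases h1 : j = p'.1 <;> by_cases h2 : k = p'.2 <;> by_cases h3 : z' = z <;> simp [h1, h2, h3]

end Kets

section Unitary

lemma submatrix_mem_unitary {κ κ' : Type} [Fintype κ] [DecidableEq κ] [Fintype κ'] [DecidableEq κ']
    {M : Matrix κ κ ℂ} (hM : M ∈ Matrix.unitaryGroup κ ℂ) (e f : κ' ≃ κ) :
    M.submatrix e f ∈ Matrix.unitaryGroup κ' ℂ := by
  rw [Matrix.mem_unitaryGroup_iff, Matrix.star_eq_conjTranspose, Matrix.conjTranspose_submatrix,
    Matrix.submatrix_mul_equiv, ← Matrix.star_eq_conjTranspose, Matrix.mem_unitaryGroup_iff.1 hM,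
    Matrix.submatrix_one_equiv]

lemma kronecker_mem_unitary {κ κ' : Type} [Fintype κ] [DecidableEq κ] [Fintype κ'] [DecidableEq κ']
    {M : Matrix κ κ ℂ} (hM : M ∈ Matrix.unitaryGroup κ ℂ) {N : Matrix κ' κ' ℂ}
    (hN : N ∈ Matrix.unitaryGroup κ' ℂ) : M ⊗ₖ N ∈ Matrix.unitaryGroup (κ × κ') ℂ := by
  rw [Matrix.mem_unitaryGroup_iff, Matrix.star_eq_conjTranspose, Matrix.conjTranspose_kronecker,
    ← Matrix.mul_kronecker_mul, ← Matrix.star_eq_conjTranspose, ← Matrix.star_eq_conjTranspose,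
    Matrix.mem_unitaryGroup_iff.1 hM, Matrix.mem_unitaryGroup_iff.1 hN, Matrix.one_kronecker_one]

lemma blockDiagonal_mem_unitary {κ κ' : Type} [Fintype κ] [DecidableEq κ] [Fintype κ']
    [DecidableEq κ'] {M : κ' → Matrix κ κ ℂ} (hM : ∀ i, M i ∈ Matrix.unitaryGroup κ ℂ) :
    Matrix.blockDiagonal M ∈ Matrix.unitaryGroup (κ × κ') ℂ := by
  rw [Matrix.mem_unitaryGroup_iff, Matrix.star_eq_conjTranspose,
    Matrix.blockDiagonal_conjTranspose, ← Matrix.blockDiagonal_mul]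
  rw [← Matrix.blockDiagonal_one]
  congr 1
  funext i
  exact Matrix.mem_unitaryGroup_iff.1 (hM i)

variable {n w : ℕ} {W : Type} [DecidableEq W]

lemma onQuery_conjTranspose (M : Matrix (QueryReg n w) (QueryReg n w) ℂ) :
    (onQuery (W := W) M)ᴴ = onQuery Mᴴ := by
  simp [onQuery, Matrix.conjTranspose_kronecker]

lemma onQuery_mem_unitary [Fintype W] {M : Matrix (QueryReg n w) (QueryReg n w) ℂ}
    (hM : M ∈ Matrix.unitaryGroup _ ℂ) : onQuery (W := W) M ∈ Matrix.unitaryGroup _ ℂ :=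
  kronecker_mem_unitary (one_mem _) (kronecker_mem_unitary hM (one_mem _))

lemma onIndices_conjTranspose
    (M : Matrix (Fin (2 ^ n) × Fin (2 ^ n)) (Fin (2 ^ n) × Fin (2 ^ n)) ℂ) :
    (onIndices (w := w) M)ᴴ = onIndices Mᴴ := by
  simp [onIndices, Matrix.conjTranspose_kronecker]

lemma onIndices_mem_unitary
    {M : Matrix (Fin (2 ^ n) × Fin (2 ^ n)) (Fin (2 ^ n) × Fin (2 ^ n)) ℂ}
    (hM : M ∈ Matrix.unitaryGroup _ ℂ) : onIndices (w := w) M ∈ Matrix.unitaryGroup _ ℂ :=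
  submatrix_mem_unitary (kronecker_mem_unitary hM (one_mem _)) _ _

end Unitary

section Gates

variable {n w : ℕ}

/-- Swap the system with the first index register and apply `U` to the second one. -/
def loadGate (n w : ℕ) (U : Matrix (Fin (2 ^ n)) (Fin (2 ^ n)) ℂ) :
    Matrix (Base n w) (Base n w) ℂ :=
  ((1 : Matrix ((Fin (2 ^ n) × Fin (2 ^ n)) × ((Fin w → Bool) × Fin 4)) _ ℂ) ⊗ₖ U).submatrix
    (⟨fun x => (((x.1, x.2.1.1), (x.2.1.2.2, x.2.2)), x.2.1.2.1),
      fun y => (y.1.1.1, ((y.1.1.2, (y.2, y.1.2.1)), y.1.2.2)), fun _ => rfl, fun _ => rfl⟩ :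
        Base n w ≃ _)
    (⟨fun x => (((x.2.1.1, x.1), (x.2.1.2.2, x.2.2)), x.2.1.2.1),
      fun y => (y.1.1.2, ((y.1.1.1, (y.2, y.1.2.1)), y.1.2.2)), fun _ => rfl, fun _ => rfl⟩ :
        Base n w ≃ _)

lemma loadGate_mem_unitary {U : Matrix (Fin (2 ^ n)) (Fin (2 ^ n)) ℂ}
    (hU : U ∈ Matrix.unitaryGroup _ ℂ) : loadGate n w U ∈ Matrix.unitaryGroup _ ℂ :=
  submatrix_mem_unitary (kronecker_mem_unitary (one_mem _) hU) _ _

lemma loadGate_mulVec_ket (U : Matrix (Fin (2 ^ n)) (Fin (2 ^ n)) ℂ) (s j k : Fin (2 ^ n))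
    (z : Fin w → Bool) (c : Fin 4) :
    loadGate n w U *ᵥ ket (s, ((j, k, z), c)) = ∑ l, U l k • ket (j, ((s, l, z), c)) := by
  ext ⟨s', ⟨j', l, z'⟩, c'⟩
  rw [mulVec_ket_apply]
  simp only [loadGate, Matrix.submatrix_apply, Equiv.coe_fn_mk, Matrix.kroneckerMap_apply,
    Matrix.one_apply, Prod.mk.injEq, Finset.sum_apply, Pi.smul_apply, ket_apply, smul_eq_mul]
  by_cases h1 : s' = j <;> by_cases h2 : j' = s <;> by_cases h3 : z' = z <;>
    by_cases h4 : c' = c <;> simp [h1, h2, h3, h4]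

/-- The decomposition of `Base` as the coin times everything else. -/
def coinFirst (n w : ℕ) : Base n w ≃ Fin 4 × (Fin (2 ^ n) × QueryReg n w) where
  toFun x := (x.2.2, (x.1, x.2.1))
  invFun y := (y.2.1, (y.2.2, y.1))
  left_inv _ := rfl
  right_inv _ := rfl

/-- Apply `A z` to the coin, controlled on the bit string `z` in the third query register. -/
def coinGate (n w : ℕ) (A : (Fin w → Bool) → Matrix (Fin 4) (Fin 4) ℂ) :
    Matrix (Base n w) (Base n w) ℂ :=
  (Matrix.blockDiagonal fun p : Fin (2 ^ n) × QueryReg n w => A p.2.2.2).submatrix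
    (coinFirst n w) (coinFirst n w)

lemma coinGate_mem_unitary {A : (Fin w → Bool) → Matrix (Fin 4) (Fin 4) ℂ}
    (hA : ∀ z, A z ∈ Matrix.unitaryGroup (Fin 4) ℂ) :
    coinGate n w A ∈ Matrix.unitaryGroup (Base n w) ℂ := by
  have h := blockDiagonal_mem_unitary
    (M := fun p : Fin (2 ^ n) × QueryReg n w => A p.2.2.2) fun p => hA p.2.2.2
  exact submatrix_mem_unitary h (coinFirst n w) (coinFirst n w)

lemma coinGate_mulVec_ket (A : (Fin w → Bool) → Matrix (Fin 4) (Fin 4) ℂ) (s : Fin (2 ^ n))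
    (q : QueryReg n w) (c : Fin 4) :
    coinGate n w A *ᵥ ket (s, (q, c)) = ∑ b, A q.2.2 b c • ket (s, (q, b)) := by
  ext ⟨s', q', c'⟩
  rw [mulVec_ket_apply]
  simp only [coinGate, coinFirst, Matrix.submatrix_apply, Equiv.coe_fn_mk, Matrix.blockDiagonal_apply,
    Prod.mk.injEq, Finset.sum_apply, Pi.smul_apply, ket_apply, smul_eq_mul]
  by_cases h1 : s' = s <;> by_cases h2 : q' = q <;> simp [h1, h2]

/-- The involution of the coin that exchanges `0` with `1` and `2` with `3`. -/
def coinFlip : Fin 4 → Fin 4 := ![1, 0, 3, 2]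

lemma coinFlip_coinFlip (c : Fin 4) : coinFlip (coinFlip c) = c := by
  fin_cases c <;> rfl

/-- Exchange the two index registers and flip the coin. -/
def swapEquiv (n w : ℕ) : Base n w ≃ Base n w where
  toFun x := (x.1, ((x.2.1.2.1, (x.2.1.1, x.2.1.2.2)), coinFlip x.2.2))
  invFun x := (x.1, ((x.2.1.2.1, (x.2.1.1, x.2.1.2.2)), coinFlip x.2.2))
  left_inv x := by simp [coinFlip_coinFlip]
  right_inv x := by simp [coinFlip_coinFlip]

/-- The unitary that permutes the basis by `swapEquiv`. -/
def swapGate (n w : ℕ) : Matrix (Base n w) (Base n w) ℂ :=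
  (1 : Matrix (Base n w) (Base n w) ℂ).submatrix (swapEquiv n w) (Equiv.refl _)

lemma swapGate_mem_unitary : swapGate n w ∈ Matrix.unitaryGroup _ ℂ :=
  submatrix_mem_unitary (one_mem _) _ _

lemma swapGate_mul {κ : Type} (M : Matrix (Base n w) κ ℂ) :
    swapGate n w * M = M.submatrix (swapEquiv n w) id := by
  ext x k
  simp [swapGate, Matrix.mul_apply, Matrix.one_apply]

lemma swapGate_mul_self : swapGate n w * swapGate n w = 1 := by
  rw [swapGate_mul]
  ext x y
  simp [swapGate, Matrix.one_apply, swapEquiv, coinFlip_coinFlip]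

end Gates

section BlockEncoding

variable {n d w : ℕ} {hd : d ≤ 2 ^ n} {val : (Fin w → Bool) → ℂ}
  {H : Matrix (Fin (2 ^ n)) (Fin (2 ^ n)) ℂ} {O : Oracles n w}

lemma bitXor_bitXor (z h : Fin w → Bool) : bitXor (bitXor z h) h = z := by
  funext i; simp [bitXor]

/-- The entry oracle is its own inverse. -/
lemma Oracles.IsFor.entry_conjTranspose (hO : O.IsFor hd val H) :
    O.OH.1ᴴ = O.OH.1 := by
  obtain ⟨h, -, hOH⟩ := hO.entries
  set M : Matrix (QueryReg n w) (QueryReg n w) ℂ := O.OH.1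
  have hMM : M * M = 1 := by
    ext x ⟨j, k, z⟩
    rw [← mulVec_ket_apply (M * M), ← mulVec_ket_apply 1, ← Matrix.mulVec_mulVec, hOH, hOH, bitXor_bitXor,
      Matrix.one_mulVec]
  have hu : Mᴴ * M = 1 := Matrix.mem_unitaryGroup_iff'.1 O.OH.2
  calc Mᴴ = Mᴴ * (M * M) := by rw [hMM, Matrix.mul_one]
    _ = M := by rw [← Matrix.mul_assoc, hu, Matrix.one_mul]

lemma prepare_mem_unitary {D A : Matrix (Base n w) (Base n w) ℂ}
    (hD : D ∈ Matrix.unitaryGroup _ ℂ) (hA : A ∈ Matrix.unitaryGroup _ ℂ) (O : Oracles n w) :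
    prepare D A O ∈ Matrix.unitaryGroup _ ℂ :=
  mul_mem (mul_mem (mul_mem (mul_mem (onQuery_mem_unitary O.OH.2) hA) (onQuery_mem_unitary O.OH.2))
    (onQuery_mem_unitary (onIndices_mem_unitary O.OF.2))) hD

lemma Oracles.IsFor.unprepare_eq (hO : O.IsFor hd val H) (D A : Matrix (Base n w) (Base n w) ℂ) :
    unprepare D A O = (prepare D A O)ᴴ := by
  rw [prepare, unprepare, Matrix.conjTranspose_mul, Matrix.conjTranspose_mul,
    Matrix.conjTranspose_mul, Matrix.conjTranspose_mul, onQuery_conjTranspose,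
    onQuery_conjTranspose, onIndices_conjTranspose, hO.entry_conjTranspose]
  simp only [Matrix.mul_assoc]

/-- The amplitudes of the uniform superposition of the first `d` basis states. -/
def uniformAmp (n d : ℕ) (k : Fin (2 ^ n)) : ℂ :=
  if (k : ℕ) < d then ((Real.sqrt d : ℝ) : ℂ)⁻¹ else 0

lemma sum_uniformAmp_smul (hd : d ≤ 2 ^ n) {M : Type} [AddCommGroup M] [Module ℂ M]
    (g : Fin (2 ^ n) → M) :
    ∑ k, uniformAmp n d k • g k =
      ∑ l : Fin d, ((Real.sqrt d : ℝ) : ℂ)⁻¹ • g (Fin.castLE hd l) := by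
  have h := Finset.sum_map (Finset.univ : Finset (Fin d)) (Fin.castLEEmb hd)
    fun k => uniformAmp n d k • g k
  rw [← Finset.sum_subset (Finset.subset_univ (Finset.univ.map (Fin.castLEEmb hd))), h]
  · refine Finset.sum_congr rfl fun l _ => ?_
    simp [uniformAmp]
  · intro k _ hk
    have : ¬ (k : ℕ) < d := by
      intro hlt
      exact hk (Finset.mem_map.2 ⟨⟨k, hlt⟩, Finset.mem_univ _, by ext; simp⟩)
    simp [uniformAmp, this]

lemma sum_norm_uniformAmp_sq (hd : d ≤ 2 ^ n) (h0 : 0 < d) :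
    ∑ k, ‖uniformAmp n d k‖ ^ 2 = 1 := by
  have h := sum_uniformAmp_smul hd (M := ℂ) fun k => star (uniformAmp n d k)
  have h2 : ((∑ k, ‖uniformAmp n d k‖ ^ 2 : ℝ) : ℂ) = 1 := by
    push_cast
    have hs : ((Real.sqrt d : ℝ) : ℂ) * ((Real.sqrt d : ℝ) : ℂ) = d := by
      rw [← Complex.ofReal_mul, Real.mul_self_sqrt (Nat.cast_nonneg d)]; simp
    have hd0 : (d : ℂ) ≠ 0 := by exact_mod_cast h0.ne'
    calc ∑ k, ((‖uniformAmp n d k‖ : ℝ) : ℂ) ^ 2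
        = ∑ k, uniformAmp n d k • star (uniformAmp n d k) :=
          Finset.sum_congr rfl fun k _ => (Complex.mul_conj' _).symm
      _ = 1 := by
          rw [h]
          simp only [uniformAmp, Fin.val_castLE, Fin.is_lt, if_true, smul_eq_mul, star_inv₀,
            Complex.star_def, Complex.conj_ofReal, Finset.sum_const, Finset.card_univ,
            Fintype.card_fin, nsmul_eq_mul]
          rw [← mul_inv, hs, mul_inv_cancel₀ hd0]
  exact_mod_cast h2

/-- The state of the coin for a matrix entry which is `γ` times the maximal one. Its overlap with
the flipped state for the entry `star γ` is `γ`. Bit strings that decode to a number exceeding the bound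
on the entries are never encountered; they get an arbitrary unit vector. -/
def coinState (γ : ℂ) : Fin 4 → ℂ :=
  if ‖γ‖ ≤ 1 then
    ![((Real.sqrt 2 : ℝ) : ℂ)⁻¹, star γ / ((Real.sqrt 2 : ℝ) : ℂ),
      ((Real.sqrt ((1 - ‖γ‖ ^ 2) / 2) : ℝ) : ℂ), 0]
  else ![1, 0, 0, 0]

lemma sum_norm_coinState_sq (γ : ℂ) : ∑ c, ‖coinState γ c‖ ^ 2 = 1 := by
  rw [coinState]
  split_ifs with h
  · have h1 : 0 ≤ (1 - ‖γ‖ ^ 2) / 2 := by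
      have := norm_nonneg γ
      have : ‖γ‖ ^ 2 ≤ 1 := pow_le_one₀ this h
      linarith
    simp only [Fin.sum_univ_four, Matrix.cons_val_zero, Matrix.cons_val_one, Matrix.cons_val,
      norm_inv, norm_div, Complex.norm_real, norm_star, Real.norm_eq_abs, sq_abs, inv_pow, div_pow,
      Real.sq_sqrt h1, Real.sq_sqrt zero_le_two, norm_zero]
    ring
  · simp [Fin.sum_univ_four]

lemma sum_coinState_mul {γ : ℂ} (h : ‖γ‖ ≤ 1) :
    ∑ c, star (coinState γ c) * coinState (star γ) (coinFlip c) = γ := by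
  have h' : ‖star γ‖ ≤ 1 := by rwa [norm_star]
  have hs : ((Real.sqrt 2 : ℝ) : ℂ) * ((Real.sqrt 2 : ℝ) : ℂ) = 2 := by
    rw [← Complex.ofReal_mul, Real.mul_self_sqrt zero_le_two]; simp
  have hs0 : ((Real.sqrt 2 : ℝ) : ℂ) ≠ 0 := by
    intro h0; rw [h0] at hs; norm_num at hs
  rw [coinState, if_pos h, coinState, if_pos h']
  simp only [Fin.sum_univ_four, coinFlip, Matrix.cons_val_zero, Matrix.cons_val_one,
    Matrix.cons_val, Complex.star_def, map_inv₀, map_div₀,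
    Complex.conj_ofReal, Complex.conj_conj, mul_zero, map_zero, zero_mul, add_zero]
  rw [inv_mul_eq_div, div_div, hs, ← div_eq_mul_inv, div_div, hs]
  ring

/-- The state prepared for row `i`, as a function of the column and the coin. -/
def rowAmp (f : Fin (2 ^ n) → Fin d → Fin (2 ^ n))
    (h : Fin (2 ^ n) → Fin (2 ^ n) → (Fin w → Bool)) (a : (Fin w → Bool) → Fin 4 → ℂ)
    (i k : Fin (2 ^ n)) (c : Fin 4) : ℂ :=
  open Classical in if ∃ l, f i l = k then ((Real.sqrt d : ℝ) : ℂ)⁻¹ * a (h i k) c else 0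

/-- The preparation maps `|i⟩` to the superposition of the columns listed for row `i`, with the coin in
the state belonging to the entry. The system register is left in `|0⟩` and the bit string is erased. -/
lemma prepare_mul_initial_apply {U : Matrix (Fin (2 ^ n)) (Fin (2 ^ n)) ℂ}
    (hU : ∀ k, U k 0 = uniformAmp n d k) {A : (Fin w → Bool) → Matrix (Fin 4) (Fin 4) ℂ}
    {f : Fin (2 ^ n) → Fin d → Fin (2 ^ n)} {h : Fin (2 ^ n) → Fin (2 ^ n) → (Fin w → Bool)}
    (hOH : ∀ j k z, (O.OH : Matrix _ _ ℂ) *ᵥ ket (j, k, z) = ket (j, k, bitXor z (h j k)))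
    (hOF : ∀ j l, (O.OF : Matrix _ _ ℂ) *ᵥ ket (j, Fin.castLE hd l) = ket (j, f j l))
    (x : Base n w) (i : Fin (2 ^ n)) :
    (prepare (loadGate n w U) (coinGate n w A) O * initial n w) x i =
      if x.1 = 0 then if x.2.1.1 = i then if x.2.1.2.2 = (fun _ => false) then
        rowAmp f h (fun z c => A z c 0) i x.2.1.2.1 x.2.2 else 0 else 0 else 0 := by
  -- Distinctness of the listed positions comes from the unitarity of the oracle.
  have hinj : ∀ j, Function.Injective (f j) := by
    intro j l l' hl
    have h1 : ∀ v : Fin (2 ^ n) × Fin (2 ^ n) → ℂ,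
        O.OF.1ᴴ *ᵥ (O.OF.1 *ᵥ v) = v := by
      intro v
      rw [Matrix.mulVec_mulVec, ← Matrix.star_eq_conjTranspose,
        Matrix.mem_unitaryGroup_iff'.1 O.OF.2, Matrix.one_mulVec]
    have h2 : ket (j, Fin.castLE hd l) = ket (j, Fin.castLE hd l') := by
      rw [← h1 (ket (j, Fin.castLE hd l)), ← h1 (ket (j, Fin.castLE hd l')), hOF, hOF, hl]
    have h3 := congrFun h2 (j, Fin.castLE hd l)
    rw [ket_apply, ket_apply, if_pos rfl] at h3
    by_contra hne
    have : ¬ ((j, Fin.castLE hd l) = (j, Fin.castLE hd l')) := by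
      simpa using hne
    rw [if_neg this] at h3
    exact one_ne_zero h3
  have hinit : initial n w *ᵥ ket i = ket (i, ((0, 0, fun _ => false), 0)) := by
    ext y
    rw [mulVec_ket_apply, ket_apply]
    rfl
  have hcol : (prepare (loadGate n w U) (coinGate n w A) O * initial n w) *ᵥ ket i =
      ∑ l : Fin d, ((Real.sqrt d : ℝ) : ℂ)⁻¹ • ∑ c, A (h i (f i l)) c 0 •
        ket (0, ((i, f i l, fun _ => false), c)) := by
    rw [prepare, ← Matrix.mulVec_mulVec, hinit, ← Matrix.mulVec_mulVec, ← Matrix.mulVec_mulVec,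
      ← Matrix.mulVec_mulVec, ← Matrix.mulVec_mulVec, loadGate_mulVec_ket]
    simp only [hU]
    rw [sum_uniformAmp_smul hd]
    simp only [Matrix.mulVec_sum, Matrix.mulVec_smul]
    refine Finset.sum_congr rfl fun l _ => ?_
    rw [onQuery_mulVec_ket (onIndices_mulVec_ket (hOF i l) _),
      onQuery_mulVec_ket (hOH _ _ _), coinGate_mulVec_ket, Matrix.mulVec_sum]
    congr 1
    refine Finset.sum_congr rfl fun c _ => ?_
    rw [Matrix.mulVec_smul, onQuery_mulVec_ket (hOH _ _ _), bitXor_bitXor]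
    congr 3
    funext b
    simp [bitXor]
  rw [← mulVec_ket_apply (prepare _ _ _ * _), hcol]
  obtain ⟨s, ⟨j, k, z⟩, b⟩ := x
  simp only [Finset.sum_apply, Pi.smul_apply, ket_apply, Prod.mk.injEq, smul_eq_mul]
  by_cases h1 : s = 0
  swap
  · simp [h1]
  by_cases h2 : j = i
  swap
  · simp [h2]
  by_cases h3 : z = fun _ => false
  swap
  · simp [h3]
  simp only [h1, h2, h3, true_and, if_true, and_true, rowAmp]
  split_ifs with hk
  · obtain ⟨l, rfl⟩ := hk
    rw [Finset.sum_eq_single l]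
    · simp
    · intro l' _ hl'
      have : f i l ≠ f i l' := fun hf => hl' (hinj i hf).symm
      simp [this]
    · simp
  · refine Finset.sum_eq_zero fun l _ => ?_
    have : k ≠ f i l := fun hf => hk ⟨l, hf.symm⟩
    simp [this]

/-- Overlaps of row states with their swapped versions: the coin contributes `H i j / Λ`, the uniform
superposition contributes `1 / d`, and positions in the list of a row that are not matched by the other
row belong to zero entries. -/
theorem blockEncoding {Λ : ℝ} (hΛ : 0 < Λ) (hH : H.IsHermitian) (hmax : maxNorm H ≤ Λ)
    (hO : O.IsFor hd val H) {U : Matrix (Fin (2 ^ n)) (Fin (2 ^ n)) ℂ}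
    (hU : ∀ k, U k 0 = uniformAmp n d k) {A : (Fin w → Bool) → Matrix (Fin 4) (Fin 4) ℂ}
    (hA : ∀ z c, A z c 0 = coinState (val z / Λ) c) :
    (prepare (loadGate n w U) (coinGate n w A) O * initial n w)ᴴ * swapGate n w *
        (prepare (loadGate n w U) (coinGate n w A) O * initial n w) =
      ((d : ℂ) * Λ)⁻¹ • H := by
  obtain ⟨h, hval, hOH⟩ := hO.entries
  obtain ⟨f, hf, hOF⟩ := hO.positions
  ext i j
  rw [Matrix.mul_assoc, swapGate_mul, Matrix.mul_apply]
  simp only [Matrix.conjTranspose_apply, Matrix.submatrix_apply, id,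
    prepare_mul_initial_apply hU hOH hOF]
  have hsum : ∑ x : Base n w, star (if x.1 = 0 then if x.2.1.1 = i then
        if x.2.1.2.2 = (fun _ => false) then
          rowAmp f h (fun z c => A z c 0) i x.2.1.2.1 x.2.2 else 0 else 0 else 0) *
        (if (swapEquiv n w x).1 = 0 then if (swapEquiv n w x).2.1.1 = j then
        if (swapEquiv n w x).2.1.2.2 = (fun _ => false) then
          rowAmp f h (fun z c => A z c 0) j (swapEquiv n w x).2.1.2.1 (swapEquiv n w x).2.2
            else 0 else 0 else 0) =
      ∑ c, star (rowAmp f h (fun z c => A z c 0) i j c) *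
        rowAmp f h (fun z c => A z c 0) j i (coinFlip c) := by
    simp only [Fintype.sum_prod_type, swapEquiv, Equiv.coe_fn_mk]
    rw [Finset.sum_eq_single 0 (fun b _ hb => by simp [hb]) (by simp),
      Finset.sum_eq_single i (fun b _ hb => by simp [hb]) (by simp),
      Finset.sum_eq_single j (fun b _ hb => by simp [hb]) (by simp),
      Finset.sum_eq_single (fun _ => false) (fun b _ hb => by simp [hb]) (by simp)]
    simp
  rw [hsum, Matrix.smul_apply, smul_eq_mul]
  have hji : H j i = star (H i j) := by rw [← hH.apply j i]
  by_cases h0 : H i j = 0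
  -- A zero entry contributes nothing even if it occurs in the lists of both rows.
  · have hcoin : ∑ c, star (coinState (0 : ℂ) c) * coinState 0 (coinFlip c) = 0 := by
      simpa using sum_coinState_mul (γ := 0) (by simp)
    rw [h0, mul_zero]
    simp only [rowAmp]
    by_cases h1 : ∃ l, f i l = j
    · by_cases h2 : ∃ l, f j l = i
      · simp only [h1, h2, if_true, hA, hval, hji, h0, star_zero, zero_div]
        calc _ = ((Real.sqrt d : ℝ) : ℂ)⁻¹ * ((Real.sqrt d : ℝ) : ℂ)⁻¹ *
              ∑ c, star (coinState (0 : ℂ) c) * coinState 0 (coinFlip c) := by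
              rw [Finset.mul_sum]
              refine Finset.sum_congr rfl fun c _ => ?_
              rw [star_mul', star_inv₀, Complex.star_def, Complex.conj_ofReal]
              ring
          _ = 0 := by rw [hcoin, mul_zero]
      · simp [h2]
    · simp [h1]
  · have h1 : ∃ l, f i l = j := hf i j h0
    have h2 : ∃ l, f j l = i := hf j i (by rw [hji]; simpa using h0)
    have hγ : ‖H i j / Λ‖ ≤ 1 := by
      rw [norm_div, Complex.norm_real, Real.norm_of_nonneg hΛ.le, div_le_one hΛ]
      refine le_trans ?_ hmax
      exact le_ciSup (f := fun p : Fin (2 ^ n) × Fin (2 ^ n) => ‖H p.1 p.2‖)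
        (Set.finite_range _).bddAbove (i, j)
    have hcoin := sum_coinState_mul hγ
    have hstar : star (H i j / Λ) = star (H i j) / Λ := by
      rw [star_div₀, Complex.star_def, Complex.conj_ofReal]
    have hs : ((Real.sqrt d : ℝ) : ℂ) * ((Real.sqrt d : ℝ) : ℂ) = d := by
      rw [← Complex.ofReal_mul, Real.mul_self_sqrt (Nat.cast_nonneg d)]; simp
    simp only [rowAmp, h1, h2, if_true, hA, hval, hji]
    calc _ = (((Real.sqrt d : ℝ) : ℂ) * ((Real.sqrt d : ℝ) : ℂ))⁻¹ *
          ∑ c, star (coinState (H i j / Λ) c) * coinState (star (H i j / Λ)) (coinFlip c) := by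
          rw [Finset.mul_sum]
          refine Finset.sum_congr rfl fun c _ => ?_
          rw [star_mul', star_inv₀, hstar, mul_inv]
          simp only [Complex.star_def, Complex.conj_ofReal]
          ring
      _ = _ := by rw [hcoin, hs, mul_inv, div_eq_mul_inv]; ring

end BlockEncoding

end

/-! ### Error estimate and query count -/

section

set_option synthInstance.maxSize 1024

open scoped Matrix.Norms.L2Operator

section Evolution

variable {n : ℕ} {H : Matrix (Fin (2 ^ n)) (Fin (2 ^ n)) ℂ}

lemma evolution_conjTranspose_mul_self (hH : H.IsHermitian) (t : ℝ) :
    (evolution H t)ᴴ * evolution H t = 1 := by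
  rw [evolution, ← Matrix.exp_conjTranspose, Matrix.conjTranspose_smul, hH.eq]
  have : star (-(Complex.I * (t : ℂ))) • H = -((-(Complex.I * (t : ℂ))) • H) := by
    rw [← neg_smul]
    congr 1
    simp
  rw [this, ← Matrix.exp_add_of_commute _ _
    (Commute.refl ((-(Complex.I * (t : ℂ))) • H)).neg_left]
  simp

end Evolution

section Circuits

variable {n w : ℕ} {W : Type} [Fintype W] [DecidableEq W]

lemma Step.op_mem_unitary (O : Oracles n w) (s : Step n w W) :
    s.op O ∈ Matrix.unitaryGroup (Fin (2 ^ n) × (QueryReg n w × W)) ℂ := by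
  cases s with
  | gate G => exact G.2
  | queryH => exact onQuery_mem_unitary O.OH.2
  | queryF => exact onQuery_mem_unitary (onIndices_mem_unitary O.OF.2)
  | queryFInv => exact onQuery_mem_unitary (onIndices_mem_unitary (Unitary.star_mem O.OF.2))

lemma stepsOp_mem_unitary (O : Oracles n w) (l : List (Step n w W)) :
    stepsOp O l ∈ Matrix.unitaryGroup (Fin (2 ^ n) × (QueryReg n w × W)) ℂ := by
  induction l with
  | nil => exact one_mem _
  | cons s l ih =>
    rw [show s :: l = [s] ++ l from rfl, stepsOp_append]
    refine mul_mem ih ?_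
    simpa [stepsOp] using s.op_mem_unitary O

end Circuits

section Estimates

lemma abs_inv_sqrt_sub_one_le {N κ : ℝ} (hκ : κ ≤ 1 / 8) (hN : |N - 1| ≤ 2 * κ) :
    (Real.sqrt N)⁻¹ ≤ 2 ∧ |(Real.sqrt N)⁻¹ - 1| ≤ 4 * κ := by
  obtain ⟨h1, h2⟩ := abs_le.1 hN
  have hN0 : 1 / 4 ≤ N := by linarith
  have hs : 1 / 2 ≤ Real.sqrt N := Real.le_sqrt_of_sq_le (by linarith)
  have hpos : 0 < Real.sqrt N := by linarith
  have hinv : (Real.sqrt N)⁻¹ ≤ 2 := by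
    rw [inv_le_comm₀ hpos two_pos]; linarith
  refine ⟨hinv, ?_⟩
  have hsq : Real.sqrt N * Real.sqrt N = N := Real.mul_self_sqrt (by linarith)
  have habs : |1 - Real.sqrt N| ≤ 2 * κ := by
    have : |N - 1| = |1 - Real.sqrt N| * (1 + Real.sqrt N) := by
      have hN' : N - 1 = -((1 - Real.sqrt N) * (1 + Real.sqrt N)) := by linear_combination -hsq
      rw [hN', abs_neg, abs_mul, abs_of_pos (show 0 < 1 + Real.sqrt N by linarith)]
    nlinarith [abs_nonneg (1 - Real.sqrt N)]
  have : (Real.sqrt N)⁻¹ - 1 = (Real.sqrt N)⁻¹ * (1 - Real.sqrt N) := by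
    rw [mul_sub, inv_mul_cancel₀ hpos.ne', mul_one]
  rw [this, abs_mul, abs_of_pos (inv_pos.2 hpos)]
  nlinarith [abs_nonneg (1 - Real.sqrt N), inv_pos.2 hpos]

/-- The truncation order makes the error parameter quadratically small in `ε`. -/
lemma exp_sub_natCeil_le {τ ε : ℝ} (hτ : 0 ≤ τ) (hε : 0 < ε) :
    Real.exp (2 * (Real.exp 1 * τ) - (⌈6 * τ + 2 * Real.log (1 / ε) + 4⌉₊ : ℕ)) ≤
      ε ^ 2 / 48 := by
  have he : Real.exp 1 ≤ 3 := by linarith [Real.exp_one_lt_d9]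
  have h4 : 48 ≤ Real.exp 4 := by
    have h := Real.exp_one_gt_d9
    have : Real.exp 4 = Real.exp 1 ^ 4 := by rw [← Real.exp_nat_mul]; norm_num
    rw [this]
    calc (48 : ℝ) ≤ 2.7 ^ 4 := by norm_num
      _ ≤ _ := by gcongr; linarith
  have hK := Nat.le_ceil (6 * τ + 2 * Real.log (1 / ε) + 4)
  calc _ ≤ Real.exp (2 * Real.log ε - 4) := by
        apply Real.exp_le_exp.2
        rw [one_div, Real.log_inv] at *
        nlinarith
    _ = ε ^ 2 / Real.exp 4 := by
        rw [Real.exp_sub, mul_comm, Real.exp_mul, Real.exp_log hε]; norm_num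
    _ ≤ ε ^ 2 / 48 := by gcongr

end Estimates

/-- Truncation of the exponential series and normalization of the completed polynomial both cost
`O(κ)`. -/
theorem norm_truncation_sub_evolution_le {n : ℕ} {H h : Matrix (Fin (2 ^ n)) (Fin (2 ^ n)) ℂ}
    (hH : H.IsHermitian) {t τ κ N : ℝ} {K : ℕ} (hτ : 0 ≤ τ) (hh : ‖h‖ ≤ 1)
    (hHh : (-(Complex.I * (τ : ℂ))) • h = (-(Complex.I * (t : ℂ))) • H)
    (hκ : κ ≤ 1 / 8) (hK : Real.exp (2 * (Real.exp 1 * τ) - K) ≤ κ) (hN : |N - 1| ≤ 2 * κ) :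
    ‖((Real.sqrt N : ℝ) : ℂ)⁻¹ • ∑ k ∈ Finset.range (K + 1),
        (k.factorial : ℂ)⁻¹ • ((-(Complex.I * (τ : ℂ))) • h) ^ k - evolution H t‖ ≤ 6 * κ := by
  set S := ∑ k ∈ Finset.range (K + 1),
        (k.factorial : ℂ)⁻¹ • ((-(Complex.I * (τ : ℂ))) • h) ^ k with hS
  set u := evolution H t with hu
  have hu1 : ‖u‖ ≤ 1 := norm_le_one_of_isometry (evolution_conjTranspose_mul_self hH t)
  have hSu : ‖S - u‖ ≤ κ := by
    rw [norm_sub_rev, hu, evolution, ← hHh, hS]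
    refine (norm_exp_sub_sum_le _ K).trans (le_trans (Real.exp_le_exp.2 ?_) hK)
    have hn : ‖(-(Complex.I * (τ : ℂ))) • h‖ ≤ τ := by
      rw [norm_smul, norm_neg, norm_mul, Complex.norm_I, one_mul, Complex.norm_real,
        Real.norm_of_nonneg hτ]
      exact mul_le_of_le_one_right hτ hh
    have he := Real.exp_pos 1
    nlinarith
  obtain ⟨h1, h2⟩ := abs_inv_sqrt_sub_one_le hκ hN
  have hc : ‖((Real.sqrt N : ℝ) : ℂ)⁻¹‖ ≤ 2 := by
    rw [norm_inv, Complex.norm_real, Real.norm_of_nonneg (Real.sqrt_nonneg _)]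
    exact h1
  have hc1 : ‖((Real.sqrt N : ℝ) : ℂ)⁻¹ - 1‖ ≤ 4 * κ := by
    rw [← Complex.ofReal_inv, ← Complex.ofReal_one, ← Complex.ofReal_sub, Complex.norm_real]
    exact h2
  have hκ0 : 0 ≤ κ := (Real.exp_pos _).le.trans hK
  have hsplit : ((Real.sqrt N : ℝ) : ℂ)⁻¹ • S - u =
      ((Real.sqrt N : ℝ) : ℂ)⁻¹ • (S - u) + (((Real.sqrt N : ℝ) : ℂ)⁻¹ - 1) • u := by
    rw [smul_sub, sub_smul, one_smul]; abel
  rw [hsplit]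
  calc _ ≤ ‖((Real.sqrt N : ℝ) : ℂ)⁻¹ • (S - u)‖ + ‖(((Real.sqrt N : ℝ) : ℂ)⁻¹ - 1) • u‖ :=
        norm_add_le _ _
    _ ≤ 2 * κ + 4 * κ * 1 := by
        rw [norm_smul, norm_smul]
        gcongr
    _ = 6 * κ := by ring

/-- Simulation with `O(τ + log (1 / ε))` queries, where `τ = d * Λ * t`. -/
theorem exists_simulation {n d w : ℕ} (hd : d ≤ 2 ^ n) (val : (Fin w → Bool) → ℂ)
    {Λ t ε : ℝ} (hd0 : 0 < d) (hΛ : 0 < Λ) (ht : 0 < t) (hε : 0 < ε) (hε1 : ε ≤ 1) :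
    ∃ A : QueryAlgorithm n w,
      A.queries = 18 * ⌈6 * (d * Λ * t) + 2 * Real.log (1 / ε) + 4⌉₊ + 6 ∧
      ∀ H : Matrix (Fin (2 ^ n)) (Fin (2 ^ n)) ℂ, H.IsHermitian → maxNorm H ≤ Λ →
        ∀ O : Oracles n w, O.IsFor hd val H → A.Simulates O H t ε := by
  set τ : ℝ := d * Λ * t with hτdef
  have hτ : 0 < τ := by positivity
  set K : ℕ := ⌈6 * τ + 2 * Real.log (1 / ε) + 4⌉₊ with hKdef
  set κ : ℝ := Real.exp (2 * (Real.exp 1 * τ) - K) with hκdef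
  have hκ : κ ≤ ε ^ 2 / 48 := exp_sub_natCeil_le hτ.le hε
  have hκ8 : κ ≤ 1 / 8 := by
    have : ε ^ 2 ≤ 1 := pow_le_one₀ hε.le hε1
    linarith
  set s : ℂ := -(Complex.I * (τ : ℂ)) with hs
  have hsstar : star s = -s := by simp [hs]
  have hsn : ‖s‖ = τ := by simp [hs, abs_of_pos hτ]
  set p := (expPoly s K).coeff with hp
  set N := completionBound (2 * K) p with hN
  have hN1 : |N - 1| ≤ 2 * κ := by
    have := abs_completionBound_sub_one_le hsstar K
    rwa [hsn] at this
  have hN0 : 0 < N := by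
    have := (abs_le.1 hN1).1
    linarith
  have hunit := unitOnCircle_binomialCompletion (L := 2 * K) (c := p)
    (fun k hk => Polynomial.coeff_eq_zero_of_natDegree_lt ((natDegree_expPoly_le s K).trans_lt hk))
    hN0
  obtain ⟨Ps, u, hlen, hPs, hu, hfac⟩ := hunit.exists_factorization (Pi.single 0 1)
  obtain ⟨U, hU, hUu⟩ := exists_unitary_column 0 u hu
  obtain ⟨B, hB, hBu⟩ := exists_unitary_column (0 : Fin (2 ^ n)) (uniformAmp n d)
    (sum_norm_uniformAmp_sq hd hd0)
  choose A hA hAu using fun z : Fin w → Bool =>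
    exists_unitary_column (0 : Fin 4) (coinState (val z / Λ)) (sum_norm_coinState_sq _)
  have hZZ := initial_conjTranspose_mul_self (n := n) (w := w)
  have hR : (2 : ℂ) • (initial n w * (initial n w)ᴴ) - 1 ∈ Matrix.unitaryGroup (Base n w) ℂ := by
    rw [Matrix.mem_unitaryGroup_iff, Matrix.star_eq_conjTranspose, reflection_conjTranspose,
      reflection_mul_self hZZ]
  obtain ⟨l, hl, hop⟩ := computes_simulationOp (n := n) (w := w) (loadGate_mem_unitary hB)
    (coinGate_mem_unitary hA) swapGate_mem_unitary hR hPs hU K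
  refine ⟨⟨Fin 4 × Fin (2 * K + 1), (0, 0), l⟩, ?_, ?_⟩
  · change (l.map Step.cost).sum = _
    -- `2 * K` controlled walk steps, `K` inverse ones and the two outer preparations.
    rw [hl, hlen]; ring
  intro H hH hmax O hO
  set V := prepare (loadGate n w B) (coinGate n w A) O with hV
  have hVu : Vᴴ * V = 1 := Matrix.mem_unitaryGroup_iff'.1
    (prepare_mem_unitary (loadGate_mem_unitary hB) (coinGate_mem_unitary hA) O)
  have henc := blockEncoding hΛ hH hmax hO hBu hAu
  set h : Matrix (Fin (2 ^ n)) (Fin (2 ^ n)) ℂ := ((d : ℂ) * Λ)⁻¹ • H with hh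
  have hkraus := krausOp_simulationOp hVu (hO.unprepare_eq _ _) swapGate_mul_self henc hPs 0 hUu
    (K := K) (c := ((Real.sqrt N : ℝ) : ℂ)⁻¹) (s := s)
    (fun k => by simp [binomialCompletion, hp, hN]) hfac
  have hT1 : ‖V * initial n w‖ ≤ 1 := by
    refine norm_le_one_of_isometry ?_
    rw [Matrix.conjTranspose_mul]
    calc _ = (initial n w)ᴴ * (Vᴴ * V) * initial n w := by simp only [Matrix.mul_assoc]
      _ = 1 := by rw [hVu, Matrix.mul_one, hZZ]
  have hh1 : ‖h‖ ≤ 1 := by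
    have hG1 : ‖swapGate n w‖ ≤ 1 :=
      norm_le_one_of_isometry (Matrix.mem_unitaryGroup_iff'.1 swapGate_mem_unitary)
    rw [← henc]
    calc _ ≤ ‖(V * initial n w)ᴴ * swapGate n w‖ * ‖V * initial n w‖ := Matrix.l2_opNorm_mul _ _
      _ ≤ (‖(V * initial n w)ᴴ‖ * ‖swapGate n w‖) * ‖V * initial n w‖ := by
          gcongr; exact Matrix.l2_opNorm_mul _ _
      _ ≤ (1 * 1) * 1 := by
          rw [Matrix.l2_opNorm_conjTranspose]
          gcongr
      _ = 1 := by norm_num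
  have hHh : s • h = (-(Complex.I * (t : ℂ))) • H := by
    have h1 : (d : ℂ) ≠ 0 := by exact_mod_cast hd0.ne'
    have h2 : (Λ : ℂ) ≠ 0 := by exact_mod_cast hΛ.ne'
    rw [hh, hs, smul_smul, hτdef]
    congr 1
    push_cast
    field_simp
  have hclose := norm_truncation_sub_evolution_le hH hτ.le hh1 hHh hκ8 le_rfl hN1
  have hbound := diamondNorm_dilated_sub_conjBy_le
    (C := stepsOp O l) (Matrix.mem_unitaryGroup_iff'.1 (stepsOp_mem_unitary O l))
    -- The bound is `2 * √(2 * δ)`, which is `ε` for this `δ`.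
    ((0, 0, fun _ => false), (0, 0)) (evolution_conjTranspose_mul_self hH t) (δ := ε ^ 2 / 8)
    (by
      rw [hop, hkraus]
      linarith)
  refine hbound.trans (ENNReal.ofReal_le_ofReal ?_)
  rw [show 2 * (ε ^ 2 / 8) = (ε / 2) ^ 2 by ring, Real.sqrt_sq (by linarith)]
  linarith

end

end HamSim

end

theorem theorem3 (α : ℝ) (hα0 : 0 < α) (hα1 : α ≤ 1) :
    ∃ C : ℝ, 0 < C ∧
      ∀ (n d w : ℕ) (hd : d ≤ 2 ^ n) (val : (Fin w → Bool) → ℂ) (Λ t ε τ : ℝ),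
        0 ≤ Λ → 0 < t → 0 < ε → ε ≤ 1 → τ = d * Λ * t → 1 ≤ τ →
        ∃ A : HamSim.QueryAlgorithm n w,
          (A.queries : ℝ) ≤
            C * (τ ^ (1 + α / 2) + τ ^ (1 - α / 2) * Real.log (1 / ε)) ∧
          ∀ H : Matrix (Fin (2 ^ n)) (Fin (2 ^ n)) ℂ,
            H.IsHermitian → HamSim.IsSparse d H → HamSim.maxNorm H ≤ Λ →
            ∀ O : HamSim.Oracles n w, O.IsFor hd val H → A.Simulates O H t ε := by
  -- `18 * (6 * τ + 2 * log (1 / ε) + 5) + 6 ≤ 204 * τ + 36 * log (1 / ε)` for `τ ≥ 1`.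
  refine ⟨204, by norm_num, ?_⟩
  intro n d w hd val Λ t ε τ hΛ ht hε hε1 hτ hτ1
  have hd0 : 0 < d := by
    rcases Nat.eq_zero_or_pos d with h | h
    · subst h; simp at hτ; linarith
    · exact h
  have hΛ0 : 0 < Λ := by
    rcases hΛ.eq_or_lt with h | h
    · rw [← h] at hτ; simp at hτ; linarith
    · exact h
  obtain ⟨A, hq, hA⟩ := HamSim.exists_simulation hd val hd0 hΛ0 ht hε hε1
  refine ⟨A, ?_, fun H hH _ hmax O hO => hA H hH hmax O hO⟩
  rw [hq, ← hτ]
  have hlog : 0 ≤ Real.log (1 / ε) := Real.log_nonneg (by rw [le_div_iff₀ hε]; linarith)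
  have h1 : τ ≤ τ ^ (1 + α / 2) := by
    conv_lhs => rw [← Real.rpow_one τ]
    exact Real.rpow_le_rpow_of_exponent_le hτ1 (by linarith)
  have h2 : 1 ≤ τ ^ (1 - α / 2) := Real.one_le_rpow hτ1 (by linarith)
  have hceil : (⌈6 * τ + 2 * Real.log (1 / ε) + 4⌉₊ : ℝ) ≤ 6 * τ + 2 * Real.log (1 / ε) + 4 + 1 :=
    (Nat.ceil_lt_add_one (by positivity)).le
  push_cast
  nlinarith
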